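/- Let $k$ be a field, let $n\ge 3$ and $d\ge 2$ be integers, let $R=k[X_1,\dots,X_n]$ with the standard grading and $\mathfrak m=(X_1,\dots,X_n)$, and let $I\subset R$ be the ideal generated by $n+1$ $k$-linearly independent forms $\mathbf f=(f_0,\dots,f_n)$ of the same degree $d$. Let $H_1=H_1(\mathbf f;R)$ be the first Koszul homology module, that is, the module of syzygies of $\mathbf f$ modulo the Koszul syzygies, graded as a subquotient of $R(-d)^{n+1}$, and let $H^0_{\mathfrak m}(H_1)$ be the graded submodule of elements killed by a power of $\mathfrak m$. For an $\mathbb N$-graded module $M$ put $\operatorname{indeg}(M)=\inf\{\mu : M_\mu\ne 0\}$, with $\operatorname{indeg}(0)=+\infty$, and define $$\mu_0(I):=(n-1)(d-1)-\min\{\operatorname{indeg}(H_1),\ \operatorname{indeg}(H^0_{\mathfrak m}(H_1))-d\}.$$ Assume that $\dim R/I\le 1$ and that for every prime ideal $\mathfrak p\supseteq I$ of $R$ the minimal number of generators of $I_{\mathfrak p}$ satisfies $\nu(I_{\mathfrak p})\le\dim R_{\mathfrak p}+1$. Then $\mu_0(I)$ is finite and $$\mu_0(I)\ \ge\ \left\lfloor\frac{(n-2)(d-1)-1}{2}\right\rfloor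 .$$ -/

import Mathlib

open MvPolynomial

noncomputable section

namespace KoszulThreshold

section Generic

variable {A : Type*} [CommRing A] {m : ℕ}

/-- The differential `K₁ → K₀` of the Koszul complex of `f`, sending `eᵢ` to `fᵢ`. -/
def d₁ (f : Fin m → A) : (Fin m → A) →ₗ[A] A :=
  Fintype.linearCombination A f

/-- The differential `K₂ → K₁` of the Koszul complex of `f`, where `K₂` is free on the
`eᵢ ∧ eⱼ` with `i < j`, sending `eᵢ ∧ eⱼ` to `fᵢ eⱼ - fⱼ eᵢ`. -/
def d₂ (f : Fin m → A) : ({p : Fin m × Fin m // p.1 < p.2} → A) →ₗ[A] (Fin m → A) :=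
  Fintype.linearCombination A
    (fun p => f p.1.1 • Pi.single p.1.2 (1 : A) - f p.1.2 • Pi.single p.1.1 (1 : A))

theorem d₁_comp_d₂ (f : Fin m → A) : d₁ f ∘ₗ d₂ f = 0 := by
  ext p
  simp [d₁, d₂, Fintype.linearCombination_apply_single, mul_comm]

/-- The first Koszul cycles `Z₁`. -/
abbrev Z₁ (f : Fin m → A) : Submodule A (Fin m → A) := LinearMap.ker (d₁ f)

/-- The first Koszul boundaries `B₁`. -/
abbrev B₁ (f : Fin m → A) : Submodule A (Fin m → A) := LinearMap.range (d₂ f)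

/-- The first Koszul homology module `H₁(f; A) = Z₁ / B₁`. -/
abbrev H₁ (f : Fin m → A) : Type _ := Z₁ f ⧸ (B₁ f).submoduleOf (Z₁ f)

/-- The zeroth local cohomology `H⁰_J(M)`: the elements of `M` killed by a power of `J`. -/
def H0 (J : Ideal A) (M : Type*) [AddCommGroup M] [Module A M] : Submodule A M where
  carrier := {x | ∃ N : ℕ, ∀ a ∈ J ^ N, a • x = 0}
  zero_mem' := ⟨0, fun _ _ => smul_zero _⟩
  add_mem' := by
    rintro x y ⟨N, hN⟩ ⟨N', hN'⟩
    refine ⟨max N N', fun a ha => ?_⟩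
    rw [smul_add, hN a (Ideal.pow_le_pow_right (le_max_left _ _) ha),
      hN' a (Ideal.pow_le_pow_right (le_max_right _ _) ha), add_zero]
  smul_mem' := by
    rintro c x ⟨N, hN⟩
    exact ⟨N, fun a ha => by rw [smul_comm, hN a ha, smul_zero]⟩

/-- The initial degree of a graded module with components `M μ`, equal to `⊤` for the zero
module. -/
def indeg {k V : Type*} [Semiring k] [AddCommMonoid V] [Module k V] (M : ℕ → Submodule k V) :
    ℕ∞ :=
  ⨅ (μ : ℕ) (_ : M μ ≠ ⊥), (μ : ℕ∞)

end Generic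

variable {k : Type*} [Field k] {n m : ℕ}

/-- The degree `μ` component of the graded module `R(-d)`, where `R = k[X₁, …, Xₙ]`. -/
def shiftedPiece (k : Type*) [Field k] (n d μ : ℕ) : Submodule k (MvPolynomial (Fin n) k) :=
  if d ≤ μ then homogeneousSubmodule (Fin n) k (μ - d) else ⊥

/-- The degree `μ` component of `Z₁ ⊆ K₁ = R(-d)ᵐ`, for forms `f` of degree `d`. -/
def Z₁piece (f : Fin m → MvPolynomial (Fin n) k) (d μ : ℕ) : Submodule k (Z₁ f) :=
  (Submodule.pi Set.univ (fun _ : Fin m => shiftedPiece k n d μ)).comap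
    ((Z₁ f).subtype.restrictScalars k)

/-- The degree `μ` component of `H₁(f; R)`, for forms `f` of degree `d`: the classes of the
cycles of degree `μ`. -/
def H₁piece (f : Fin m → MvPolynomial (Fin n) k) (d μ : ℕ) : Submodule k (H₁ f) :=
  (Z₁piece f d μ).map ((((B₁ f).submoduleOf (Z₁ f)).mkQ).restrictScalars k)

/-- The degree `μ` component of `H⁰_𝔪(H₁(f; R))`, with `𝔪 = (X₁, …, Xₙ)`. -/
def H0H₁piece (f : Fin m → MvPolynomial (Fin n) k) (d μ : ℕ) : Submodule k (H₁ f) :=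
  (H0 (idealOfVars (Fin n) k) (H₁ f)).restrictScalars k ⊓ H₁piece f d μ

/-- `min {indeg H₁, indeg H⁰_𝔪(H₁) - d}`, where `⊤` stands for `+∞`. -/
def minIndeg (f : Fin m → MvPolynomial (Fin n) k) (d : ℕ) : WithTop ℤ :=
  min (ENat.map (fun a : ℕ => (a : ℤ)) (indeg (H₁piece f d)))
    (ENat.map (fun a : ℕ => (a : ℤ) - d) (indeg (H0H₁piece f d)))

/-- The threshold degree `(n-1)(d-1) - min {indeg H₁, indeg H⁰_𝔪(H₁) - d}` of the ideal generated
by the forms `f` of degree `d`. It would be `-∞`, written `⊥`, if the minimum were `+∞`. -/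
def thresholdDegree (f : Fin m → MvPolynomial (Fin n) k) (d : ℕ) : WithBot ℤ :=
  match minIndeg f d with
  | ⊤ => ⊥
  | (a : ℤ) => (((n : ℤ) - 1) * ((d : ℤ) - 1) - a : ℤ)

end KoszulThreshold

end

/-! Put m = n - 1 and M = ⌊(m - 1)(d - 1)/2⌋. It suffices that the minimum defining μ₀ is at most M
+ d. Otherwise H₁ vanishes in degrees ≤ M + d, so syzygies with coefficients of degree ≤ M are
Koszul (`KoszulUpTo`), and the 𝔪-torsion of H₁ vanishes in degrees ≤ M + 2d, that is, in coefficient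
degrees ≤ M + d (`TorsionFreeUpTo`). Both conditions survive passage to the algebraic closure, so
the field may be taken infinite.

Since dim R/I ≤ 1, m general combinations g of the forms are a regular sequence
(`exists_regular_combinations`); two more, a and b, complete an invertible change of generators. Let
S = R/(g), with Hilbert function h, and let l be a linear form regular on S. The Hilbert function of
S/(l) is G, the coefficients of (1 + t + ⋯ + t^(d-1))^m: symmetric, and strictly increasing up to
the middle.

Two facts about B = R/(g, a, b) now conflict. Vanishing of H₁ makes the Koszul complex of a, b over
S exact in low degrees, so B has Hilbert function h(i) - 2h(i-d) + h(i-2d) for i ≤ M + d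
(`KoszulUpTo.hilb_eq`). Vanishing of the torsion makes l injective on B from degree M + d - 1 to M +
d (`TorsionFreeUpTo.mem_of_mul_mem`): by duality in S/(l^N), a kernel element would produce a
torsion class of coefficient degree m(d-1) - M ≤ M + d. Hence G(M+d) - 2G(M) + G(M-d) ≥ 0. But
G(M+d) ≤ G(M) by symmetry, and G(M-d) ≤ G(M-1) < G(M). -/

noncomputable section

namespace KoszulThreshold

/-! ### Integer-graded pieces, homogeneous ideals and regular elements -/

section Pieces

variable {K : Type*} [Field K] {n : ℕ}

/-- The homogeneous piece of degree `i` of the polynomial ring, for an integer `i`. -/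
def homPiece (K : Type*) [Field K] (n : ℕ) (i : ℤ) : Submodule K (MvPolynomial (Fin n) K) :=
  if 0 ≤ i then homogeneousSubmodule (Fin n) K i.toNat else ⊥

/-- The projection to the homogeneous piece of degree `i`, for an integer `i`. -/
def comp (i : ℤ) : MvPolynomial (Fin n) K →ₗ[K] MvPolynomial (Fin n) K :=
  if 0 ≤ i then homogeneousComponent i.toNat else 0

theorem homPiece_natCast (c : ℕ) : homPiece K n (c : ℤ) = homogeneousSubmodule (Fin n) K c := by
  simp [homPiece]

theorem mem_homPiece_natCast {c : ℕ} {p : MvPolynomial (Fin n) K} :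
    p ∈ homPiece K n (c : ℤ) ↔ p.IsHomogeneous c := by
  rw [homPiece_natCast, mem_homogeneousSubmodule]

theorem homPiece_of_neg {i : ℤ} (hi : i < 0) : homPiece K n i = ⊥ := by
  simp [homPiece, not_le.mpr hi]

theorem homPiece_cases {i : ℤ} {p : MvPolynomial (Fin n) K} (hp : p ∈ homPiece K n i) :
    p = 0 ∨ ∃ c : ℕ, i = c ∧ p.IsHomogeneous c := by
  rcases lt_or_ge i 0 with hi | hi
  · rw [homPiece_of_neg hi] at hp
    exact Or.inl hp
  · obtain ⟨c, rfl⟩ := Int.eq_ofNat_of_zero_le hi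
    exact Or.inr ⟨c, rfl, mem_homPiece_natCast.1 hp⟩

theorem mul_mem_homPiece {i j : ℤ} {p q : MvPolynomial (Fin n) K} (hp : p ∈ homPiece K n i)
    (hq : q ∈ homPiece K n j) : p * q ∈ homPiece K n (i + j) := by
  rcases homPiece_cases hp with rfl | ⟨a, rfl, ha⟩
  · simp
  rcases homPiece_cases hq with rfl | ⟨b, rfl, hb⟩
  · simp
  rw [← Nat.cast_add, mem_homPiece_natCast]
  exact ha.mul hb

theorem comp_mem (i : ℤ) (p : MvPolynomial (Fin n) K) : comp i p ∈ homPiece K n i := by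
  unfold comp homPiece
  split_ifs
  · exact homogeneousComponent_mem _ _
  · simp

theorem comp_of_mem {i : ℤ} {p : MvPolynomial (Fin n) K} (hp : p ∈ homPiece K n i) (j : ℤ) :
    comp j p = if j = i then p else 0 := by
  rcases homPiece_cases hp with rfl | ⟨a, rfl, ha⟩
  · simp
  unfold comp
  split_ifs with h1 h2 h2
  · subst h2
    simpa using homogeneousComponent_of_mem (m := a) ha
  · obtain ⟨b, rfl⟩ := Int.eq_ofNat_of_zero_le h1
    rw [Int.toNat_natCast, homogeneousComponent_of_mem ha, if_neg (by exact_mod_cast h2)]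
  · omega
  · rfl

theorem comp_self {i : ℤ} {p : MvPolynomial (Fin n) K} (hp : p ∈ homPiece K n i) :
    comp i p = p := by simp [comp_of_mem hp]

theorem sum_comp (p : MvPolynomial (Fin n) K) :
    ∑ i ∈ Finset.range (p.totalDegree + 1), comp (i : ℤ) p = p := by
  simpa [comp] using sum_homogeneousComponent p

theorem hom_induction {motive : MvPolynomial (Fin n) K → Prop}
    (add : ∀ p q, motive p → motive q → motive (p + q))
    (hom : ∀ (i : ℤ) (p), p ∈ homPiece K n i → motive p) (p : MvPolynomial (Fin n) K) :
    motive p := by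
  rw [← sum_comp p]
  exact Finset.sum_induction _ motive add (hom 0 0 (zero_mem _)) fun i _ => hom i _ (comp_mem _ _)

theorem comp_mul {e : ℤ} {y : MvPolynomial (Fin n) K} (hy : y ∈ homPiece K n e) (i : ℤ)
    (p : MvPolynomial (Fin n) K) : comp i (y * p) = y * comp (i - e) p := by
  induction p using hom_induction with
  | add p q hp hq => rw [mul_add, map_add, hp, hq, map_add, mul_add]
  | hom j p hp =>
    rw [comp_of_mem hp, comp_of_mem (mul_mem_homPiece hy hp)]
    by_cases h : i = e + j
    · simp [h]
    · rw [if_neg h, if_neg (by omega), mul_zero]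

theorem mem_of_comp_mem {Q : Ideal (MvPolynomial (Fin n) K)} {p : MvPolynomial (Fin n) K}
    (h : ∀ i, comp i p ∈ Q) : p ∈ Q := by
  rw [← sum_comp p]
  exact Q.sum_mem fun i _ => h i

theorem X_mem_homPiece (i : Fin n) : (X i : MvPolynomial (Fin n) K) ∈ homPiece K n 1 := by
  have := mem_homPiece_natCast.2 (isHomogeneous_X K i)
  simpa using this

theorem pow_mem_homPiece {e : ℤ} {y : MvPolynomial (Fin n) K} (hy : y ∈ homPiece K n e) (N : ℕ) :
    y ^ N ∈ homPiece K n (N * e) := by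
  induction N with
  | zero => simpa using mem_homPiece_natCast.2 (isHomogeneous_one (Fin n) K)
  | succ N ih =>
    rw [pow_succ]
    have := mul_mem_homPiece ih hy
    rwa [show (N : ℤ) * e + e = ((N + 1 : ℕ) : ℤ) * e by push_cast; ring] at this

theorem mem_idealOfVars_of_mem_homPiece {e : ℤ} (he : 0 < e) {y : MvPolynomial (Fin n) K}
    (hy : y ∈ homPiece K n e) : y ∈ idealOfVars (Fin n) K := by
  rcases homPiece_cases hy with rfl | ⟨a, rfl, ha⟩
  · simp
  have := mem_pow_idealOfVars_iff' 1 y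
  rw [pow_one] at this
  rw [this]
  intro x hx
  exact ha.coeff_eq_zero (by omega)

/-- An ideal containing the homogeneous components of all its elements. -/
def IsHomog (Q : Ideal (MvPolynomial (Fin n) K)) : Prop := ∀ p ∈ Q, ∀ i, comp i p ∈ Q

theorem IsHomog.sup {Q Q' : Ideal (MvPolynomial (Fin n) K)} (h : IsHomog Q) (h' : IsHomog Q') :
    IsHomog (Q ⊔ Q') := by
  intro p hp i
  obtain ⟨q, hq, q', hq', rfl⟩ := Submodule.mem_sup.1 hp
  rw [map_add]
  exact Ideal.add_mem _ (Ideal.mem_sup_left (h _ hq i)) (Ideal.mem_sup_right (h' _ hq' i))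

theorem isHomog_span_singleton {e : ℤ} {y : MvPolynomial (Fin n) K} (hy : y ∈ homPiece K n e) :
    IsHomog (Ideal.span {y}) := by
  intro p hp i
  obtain ⟨t, rfl⟩ := Ideal.mem_span_singleton'.1 hp
  rw [mul_comm, comp_mul hy]
  exact Ideal.mul_mem_right _ _ (Ideal.mem_span_singleton_self y)

theorem IsHomog.sup_span {Q : Ideal (MvPolynomial (Fin n) K)} (h : IsHomog Q) {e : ℤ}
    {y : MvPolynomial (Fin n) K} (hy : y ∈ homPiece K n e) : IsHomog (Q ⊔ Ideal.span {y}) :=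
  h.sup (isHomog_span_singleton hy)

theorem isHomog_span_range {ι : Type*} [Fintype ι] {e : ℤ} {F : ι → MvPolynomial (Fin n) K}
    (hF : ∀ i, F i ∈ homPiece K n e) : IsHomog (Ideal.span (Set.range F)) := by
  intro p hp j
  obtain ⟨c, rfl⟩ := (Ideal.mem_span_range_iff_exists_fun).1 hp
  rw [map_sum]
  refine Ideal.sum_mem _ fun i _ => ?_
  rw [mul_comm, comp_mul (hF i)]
  exact Ideal.mul_mem_right _ _ (Ideal.subset_span ⟨i, rfl⟩)

theorem mem_sup_span_singleton {A : Type*} [CommRing A] {Q : Ideal A} {x y : A} :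
    x ∈ Q ⊔ Ideal.span {y} ↔ ∃ t, x - y * t ∈ Q := by
  constructor
  · intro h
    obtain ⟨q, hq, q', hq', rfl⟩ := Submodule.mem_sup.1 h
    obtain ⟨t, rfl⟩ := Ideal.mem_span_singleton'.1 hq'
    exact ⟨t, by rwa [mul_comm y t, add_sub_cancel_right]⟩
  · rintro ⟨t, ht⟩
    rw [← sub_add_cancel x (y * t)]
    exact Ideal.add_mem _ (Ideal.mem_sup_left ht)
      (Ideal.mem_sup_right (Ideal.mul_mem_right _ _ (Ideal.mem_span_singleton_self y)))

theorem IsHomog.exists_of_mem_sup_span {Q : Ideal (MvPolynomial (Fin n) K)} (h : IsHomog Q)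
    {e i : ℤ} {x y : MvPolynomial (Fin n) K} (hy : y ∈ homPiece K n e) (hx : x ∈ homPiece K n i)
    (hxy : x ∈ Q ⊔ Ideal.span {y}) : ∃ t ∈ homPiece K n (i - e), x - y * t ∈ Q := by
  obtain ⟨t, ht⟩ := mem_sup_span_singleton.1 hxy
  refine ⟨comp (i - e) t, comp_mem _ _, ?_⟩
  have := h _ ht i
  rwa [map_sub, comp_self hx, comp_mul hy] at this

/-- Multiplication by `y` is injective on `A ⧸ Q`. -/
def IsRegOn {A : Type*} [CommRing A] (y : A) (Q : Ideal A) : Prop := ∀ x, y * x ∈ Q → x ∈ Q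

theorem IsRegOn.pow {A : Type*} [CommRing A] {y : A} {Q : Ideal A} (h : IsRegOn y Q) (N : ℕ) :
    IsRegOn (y ^ N) Q := by
  induction N with
  | zero => intro x hx; simpa using hx
  | succ N ih => intro x hx; exact h _ (ih _ (by rwa [← mul_assoc, ← pow_succ]))

/-- If `y` is regular modulo `Q` and `w` is regular modulo `Q + (y)`, then `y` is regular
modulo `Q + (w)`. -/
theorem IsRegOn.swap {A : Type*} [CommRing A] {y w : A} {Q : Ideal A} (hy : IsRegOn y Q)
    (hw : IsRegOn w (Q ⊔ Ideal.span {y})) : IsRegOn y (Q ⊔ Ideal.span {w}) := by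
  intro x hx
  obtain ⟨t, ht⟩ := mem_sup_span_singleton.1 hx
  obtain ⟨s, hs⟩ := mem_sup_span_singleton.1 (hw t (mem_sup_span_singleton.2 ⟨x, by
    have := Q.neg_mem ht
    rwa [neg_sub] at this⟩))
  refine mem_sup_span_singleton.2 ⟨s, hy _ ?_⟩
  have := Q.add_mem ht (Q.mul_mem_left w hs)
  convert this using 1
  ring

end Pieces

/-! ### Prime avoidance over an infinite field -/

section Avoidance

variable {K : Type*} [Field K] [Infinite K]

/-- A subspace avoids finitely many proper subspaces. -/
theorem exists_mem_forall_notMem {E : Type*} [AddCommGroup E] [Module K E] (V : Submodule K E)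
    {ι : Type*} {s : Set ι} (hs : s.Finite) (W : ι → Submodule K E) (h : ∀ i ∈ s, ¬ V ≤ W i) :
    ∃ v ∈ V, ∀ i ∈ s, v ∉ W i := by
  by_contra! hcon
  have : Finite s := hs
  have hcov : ⋃ i : s, (((W i).comap V.subtype : Submodule K V) : Set V) = Set.univ := by
    ext v
    obtain ⟨i, hi, hv⟩ := hcon v v.2
    simp only [Set.mem_iUnion, Set.mem_univ, iff_true]
    exact ⟨⟨i, hi⟩, hv⟩
  obtain ⟨i, hi⟩ := Subspace.exists_eq_top_of_iUnion_eq_univ hcov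
  exact h i i.2 fun v hv => by
    have : (⟨v, hv⟩ : V) ∈ (W i).comap V.subtype := hi ▸ Submodule.mem_top
    exact this

/-- A subspace `V` contains an element regular modulo each of finitely many ideals, provided that
no element outside one of the ideals is multiplied into it by all of `V`. -/
theorem exists_mem_forall_isRegOn {A : Type*} [CommRing A] [IsNoetherianRing A] [Algebra K A]
    (V : Submodule K A) {s : Set (Ideal A)} (hs : s.Finite)
    (h : ∀ Q ∈ s, ∀ x, (∀ v ∈ V, v * x ∈ Q) → x ∈ Q) : ∃ v ∈ V, ∀ Q ∈ s, IsRegOn v Q := by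
  -- An element outside all associated primes of `A ⧸ Q` is regular on it. If `V` lay in such a
  -- prime, the annihilator of the class of some `x`, then `h` would put `x` in `Q` and the prime
  -- would be the whole ring.
  obtain ⟨v, hv, hv'⟩ := exists_mem_forall_notMem V
    (hs.biUnion fun Q _ => associatedPrimes.finite A (A ⧸ Q))
    (fun P : Ideal A => P.restrictScalars K) (by
      intro P hP hle
      obtain ⟨Q, hQ, hP⟩ := Set.mem_iUnion₂.1 hP
      have hP' := hP.isPrime
      obtain ⟨x, hx⟩ := ((isAssociatedPrime_iff).1 hP).2
      obtain ⟨x, rfl⟩ := Ideal.Quotient.mk_surjective x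
      have hmem : ∀ v, v ∈ P ↔ v * x ∈ Q := by
        intro v
        rw [hx, Submodule.mem_colon_singleton, ← Ideal.Quotient.mk_eq_mk,
          ← Submodule.Quotient.mk_smul,
          Ideal.Quotient.mk_eq_mk, Submodule.mem_bot, Ideal.Quotient.eq_zero_iff_mem, smul_eq_mul]
      apply hP'.ne_top
      rw [Ideal.eq_top_iff_one, hmem, one_mul]
      exact h Q hQ x fun v hv => (hmem v).1 (hle hv))
  refine ⟨v, hv, fun Q hQ x hx => ?_⟩
  by_contra hxQ
  have : v ∈ ⋃ p ∈ associatedPrimes A (A ⧸ Q), (p : Set A) := by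
    rw [biUnion_associatedPrimes_eq_zero_divisors]
    refine ⟨Ideal.Quotient.mk Q x, fun h0 => hxQ (Ideal.Quotient.eq_zero_iff_mem.1 h0), ?_⟩
    rw [← Ideal.Quotient.mk_eq_mk, ← Submodule.Quotient.mk_smul,
          Ideal.Quotient.mk_eq_mk, Ideal.Quotient.eq_zero_iff_mem, smul_eq_mul]
    exact hx
  obtain ⟨P, hP, hvP⟩ := Set.mem_iUnion₂.1 this
  exact hv' P (Set.mem_iUnion₂.2 ⟨Q, hQ, hP⟩) hvP

end Avoidance

/-! ### Socles modulo regular sequences, and exchange of sequence elements -/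

section Exchange

variable {K : Type*} [Field K] {n : ℕ}

/-- No nonzero element of `R ⧸ Q` is killed by all variables. -/
def SocleFree (Q : Ideal (MvPolynomial (Fin n) K)) : Prop :=
  ∀ x, (∀ i, X i * x ∈ Q) → x ∈ Q

/-- The elements of `R ⧸ Q` killed by all variables form a line in degree `σ`. -/
def SocleLine (σ : ℤ) (Q : Ideal (MvPolynomial (Fin n) K)) : Prop :=
  ∃ s ∈ homPiece K n σ, s ∉ Q ∧ (∀ i, X i * s ∈ Q) ∧
    ∀ x, (∀ i, X i * x ∈ Q) → ∃ c : K, x - C c * s ∈ Q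

/-- `R ⧸ Q` becomes a ring with one-dimensional socle, in degree `σ`, after killing a regular
sequence of `r` linear forms. -/
def GorSocle : ℕ → ℤ → Ideal (MvPolynomial (Fin n) K) → Prop
  | 0, σ, Q => SocleLine σ Q
  | r + 1, σ, Q => ∃ z ∈ homPiece K n 1, IsRegOn z Q ∧ GorSocle r σ (Q ⊔ Ideal.span {z})

theorem mul_mem_of_mem_idealOfVars {Q : Ideal (MvPolynomial (Fin n) K)}
    {x y : MvPolynomial (Fin n) K} (hy : y ∈ idealOfVars (Fin n) K) (hx : ∀ i, X i * x ∈ Q) :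
    y * x ∈ Q := by
  have : idealOfVars (Fin n) K ≤ Submodule.comap (LinearMap.toSpanSingleton _ _ x) Q := by
    rw [idealOfVars, Ideal.span_le]
    rintro _ ⟨i, rfl⟩
    exact hx i
  exact this hy

theorem socleFree_of_isRegOn {Q : Ideal (MvPolynomial (Fin n) K)} {z : MvPolynomial (Fin n) K}
    (hz : z ∈ idealOfVars (Fin n) K) (h : IsRegOn z Q) : SocleFree Q :=
  fun x hx => h x (mul_mem_of_mem_idealOfVars hz hx)

theorem GorSocle.socleFree {r : ℕ} {σ : ℤ} {Q : Ideal (MvPolynomial (Fin n) K)}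
    (h : GorSocle (r + 1) σ Q) : SocleFree Q := by
  obtain ⟨z, hz, hzQ, -⟩ := h
  exact socleFree_of_isRegOn (mem_idealOfVars_of_mem_homPiece one_pos hz) hzQ

variable {Q : Ideal (MvPolynomial (Fin n) K)} {y z : MvPolynomial (Fin n) K}

/-- Both socles are copies of Ext¹(K, R/Q). Concretely, a socle element x modulo (y) satisfies zx =
yp with p a socle element modulo (z); then p = zr, and cancelling z gives x = yr. -/
theorem SocleFree.exchange (hz : z ∈ idealOfVars (Fin n) K) (hzQ : IsRegOn z Q)
    (hyQ : IsRegOn y Q) (h : SocleFree (Q ⊔ Ideal.span {z})) :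
    SocleFree (Q ⊔ Ideal.span {y}) := by
  intro x hx
  obtain ⟨p, hp⟩ := mem_sup_span_singleton.1 (mul_mem_of_mem_idealOfVars hz hx)
  obtain ⟨r, hr⟩ := mem_sup_span_singleton.1 (h p fun i => by
    obtain ⟨q, hq⟩ := mem_sup_span_singleton.1 (hx i)
    refine mem_sup_span_singleton.2 ⟨q, hyQ _ ?_⟩
    have := Q.sub_mem (Q.mul_mem_left z hq) (Q.mul_mem_left (X i) hp)
    convert this using 1
    ring)
  refine mem_sup_span_singleton.2 ⟨r, hzQ _ ?_⟩
  have := Q.add_mem hp (Q.mul_mem_left y hr)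
  convert this using 1
  ring

/-- The relation ys = zt modulo Q sends the socle generator s modulo (z) to a socle generator t
modulo (y); comparing degrees gives the shift e - 1. -/
theorem SocleLine.exchange (hQ : IsHomog Q) (hz : z ∈ homPiece K n 1) (hzQ : IsRegOn z Q)
    {e σ : ℤ} (he : 0 < e) (hy : y ∈ homPiece K n e) (hyQ : IsRegOn y Q)
    (h : SocleLine σ (Q ⊔ Ideal.span {z})) : SocleLine (σ + (e - 1)) (Q ⊔ Ideal.span {y}) := by
  obtain ⟨s, hs, hsQ, hXs, hline⟩ := h
  obtain ⟨t, ht, hyt⟩ := hQ.exists_of_mem_sup_span hz (mul_mem_homPiece hy hs)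
    (mul_mem_of_mem_idealOfVars (mem_idealOfVars_of_mem_homPiece he hy) hXs)
  refine ⟨t, by convert ht using 2; ring, fun hmem => ?_, fun i => ?_, fun x hx => ?_⟩
  · obtain ⟨t', ht'⟩ := mem_sup_span_singleton.1 hmem
    refine hsQ (mem_sup_span_singleton.2 ⟨t', hyQ _ ?_⟩)
    have := Q.add_mem hyt (Q.mul_mem_left z ht')
    convert this using 1
    ring
  · obtain ⟨p, hp⟩ := mem_sup_span_singleton.1 (hXs i)
    refine mem_sup_span_singleton.2 ⟨p, hzQ _ ?_⟩
    have := Q.sub_mem (Q.mul_mem_left y hp) (Q.mul_mem_left (X i) hyt)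
    convert this using 1
    ring
  · obtain ⟨p, hp⟩ := mem_sup_span_singleton.1
      (mul_mem_of_mem_idealOfVars (mem_idealOfVars_of_mem_homPiece one_pos hz) hx)
    obtain ⟨c, hc⟩ := hline p fun i => by
      obtain ⟨q, hq⟩ := mem_sup_span_singleton.1 (hx i)
      refine mem_sup_span_singleton.2 ⟨q, hyQ _ ?_⟩
      have := Q.sub_mem (Q.mul_mem_left z hq) (Q.mul_mem_left (X i) hp)
      convert this using 1
      ring
    obtain ⟨r, hr⟩ := mem_sup_span_singleton.1 hc
    refine ⟨c, mem_sup_span_singleton.2 ⟨r, hzQ _ ?_⟩⟩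
    have := Q.add_mem (Q.add_mem hp (Q.mul_mem_left y hr)) (Q.mul_mem_left (C c) hyt)
    convert this using 1
    ring

theorem exists_linear_isRegOn [Infinite K] {s : Set (Ideal (MvPolynomial (Fin n) K))}
    (hs : s.Finite) (h : ∀ Q ∈ s, SocleFree Q) :
    ∃ w ∈ homPiece K n 1, ∀ Q ∈ s, IsRegOn w Q :=
  exists_mem_forall_isRegOn _ hs fun Q hQ x hx => h Q hQ x fun i => hx _ (X_mem_homPiece i)

/-- The rest of the given sequence need not stay regular next to y. A linear form w regular modulo
Q, Q + (z) and Q + (y) mediates: induction replaces the next element by w modulo Q + (z), and then z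
by y modulo Q + (w). -/
theorem GorSocle.exchange [Infinite K] {r : ℕ} {σ e : ℤ} (hQ : IsHomog Q) (he : 0 < e)
    (hy : y ∈ homPiece K n e) (hyQ : IsRegOn y Q) (h : GorSocle (r + 1) σ Q) :
    GorSocle r (σ + (e - 1)) (Q ⊔ Ideal.span {y}) := by
  induction r generalizing σ e Q y with
  | zero =>
    obtain ⟨z, hz, hzQ, h⟩ := h
    exact SocleLine.exchange hQ hz hzQ he hy hyQ h
  | succ r ih =>
    have hfree := h.socleFree
    obtain ⟨z, hz, hzQ, h⟩ := h
    have hfree' := h.socleFree.exchange (mem_idealOfVars_of_mem_homPiece one_pos hz) hzQ hyQ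
    obtain ⟨w, hw, hwreg⟩ := exists_linear_isRegOn
      (s := {Q, Q ⊔ Ideal.span {z}, Q ⊔ Ideal.span {y}}) (Set.toFinite _) (by
        rintro _ (rfl | rfl | rfl)
        exacts [hfree, h.socleFree, hfree'])
    have hwQ := hwreg Q (by simp)
    have hwz := hwreg (Q ⊔ Ideal.span {z}) (by simp)
    have hwy := hwreg (Q ⊔ Ideal.span {y}) (by simp)
    have h1 := ih (hQ.sup_span hz) one_pos hw hwz h
    rw [sub_self, add_zero, sup_right_comm] at h1
    have h2 := ih (hQ.sup_span hw) he hy (hyQ.swap hwy) ⟨z, hz, hzQ.swap hwz, h1⟩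
    rw [sup_right_comm] at h2
    exact ⟨w, hw, hwy, h2⟩

/-- The ideal of the polynomial ring generated by the variables with index at least `r`. -/
def varIdeal (K : Type*) [Field K] (n r : ℕ) : Ideal (MvPolynomial (Fin n) K) :=
  Ideal.span (X '' {i : Fin n | r ≤ i})

theorem varIdeal_self : varIdeal K n n = ⊥ := by
  have : {i : Fin n | n ≤ i} = ∅ := by ext i; simp
  simp [varIdeal, this]

theorem varIdeal_succ {r : ℕ} (hr : r < n) :
    varIdeal K n (r + 1) ⊔ Ideal.span {X ⟨r, hr⟩} = varIdeal K n r := by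
  rw [varIdeal, varIdeal, ← Ideal.span_union, ← Set.image_singleton, ← Set.image_union]
  congr 2
  ext i
  simp only [Set.mem_union, Set.mem_ofPred_eq, Set.mem_singleton_iff, Fin.ext_iff]
  omega

theorem isRegOn_varIdeal {r : ℕ} (hr : r < n) :
    IsRegOn (X ⟨r, hr⟩) (varIdeal K n (r + 1)) := by
  intro x hx
  rw [varIdeal, mem_ideal_span_X_image] at hx ⊢
  intro m hm
  obtain ⟨i, hi, h⟩ := hx (Finsupp.single ⟨r, hr⟩ 1 + m) (by
    rw [support_X_mul]
    exact Finset.mem_map.2 ⟨m, hm, rfl⟩)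
  refine ⟨i, hi, ?_⟩
  rw [Finsupp.add_apply, Finsupp.single_apply, if_neg, zero_add] at h
  · exact h
  · rintro rfl
    simp at hi

theorem isHomog_varIdeal (r : ℕ) : IsHomog (varIdeal K n r) := by
  rw [varIdeal, ← Set.range_domRestrict]
  exact isHomog_span_range fun i => X_mem_homPiece _

theorem gorSocle_varIdeal {r : ℕ} (hr : r ≤ n) : GorSocle r 0 (varIdeal K n r) := by
  induction r with
  | zero =>
    refine ⟨1, ?_, ?_, fun i => ?_, fun x _ => ⟨coeff 0 x, ?_⟩⟩
    · exact mem_homPiece_natCast.2 (isHomogeneous_one (Fin n) K)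
    · rw [varIdeal, mem_ideal_span_X_image]
      intro h
      obtain ⟨i, -, hi⟩ := h 0 (by simp)
      simp at hi
    · rw [mul_one]
      exact Ideal.subset_span ⟨i, by simp⟩
    · rw [varIdeal, mem_ideal_span_X_image]
      intro m hm
      by_contra! hcon
      have : m = 0 := by ext i; exact hcon i (by simp)
      simp [this] at hm
  | succ r ih =>
    refine ⟨X ⟨r, hr⟩, X_mem_homPiece _, isRegOn_varIdeal hr, ?_⟩
    rw [varIdeal_succ hr]
    exact ih (by omega)

theorem gorSocle_bot : GorSocle n 0 (⊥ : Ideal (MvPolynomial (Fin n) K)) := by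
  have := gorSocle_varIdeal (K := K) (le_refl n)
  rwa [varIdeal_self] at this

end Exchange

/-! ### Hilbert functions of graded quotients -/

section HilbertFunction

theorem finrank_map_add_finrank_inf_ker {K V W : Type*} [Field K] [AddCommGroup V] [Module K V]
    [AddCommGroup W] [Module K W] (φ : V →ₗ[K] W) (P : Submodule K V) [FiniteDimensional K P] :
    Module.finrank K (P.map φ) + Module.finrank K (P ⊓ LinearMap.ker φ : Submodule K V) =
      Module.finrank K P := by
  rw [← LinearMap.finrank_range_add_finrank_ker (φ.domRestrict P), LinearMap.range_domRestrict,
    LinearMap.ker_domRestrict]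
  congr 1
  rw [← Submodule.map_comap_subtype,
    LinearEquiv.finrank_eq (Submodule.equivMapOfInjective _ P.injective_subtype _)]

theorem finrank_map_of_injective {K V W : Type*} [Field K] [AddCommGroup V] [Module K V]
    [AddCommGroup W] [Module K W] {φ : V →ₗ[K] W} (h : Function.Injective φ)
    (P : Submodule K V) : Module.finrank K (P.map φ) = Module.finrank K P :=
  (LinearEquiv.finrank_eq (Submodule.equivMapOfInjective φ h P)).symm

variable {K : Type*} [Field K] {n : ℕ}

instance (i : ℤ) : FiniteDimensional K (homPiece K n i) := by
  refine Module.Finite.iff_fg.2 ?_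
  unfold homPiece
  split_ifs
  · exact homogeneousSubmodule_fg _ _ _
  · exact Submodule.fg_bot

/-- The degree `i` component of `R ⧸ Q`. -/
def quotPiece (Q : Ideal (MvPolynomial (Fin n) K)) (i : ℤ) :
    Submodule K (MvPolynomial (Fin n) K ⧸ Q) :=
  (homPiece K n i).map (Ideal.Quotient.mkₐ K Q).toLinearMap

instance (Q : Ideal (MvPolynomial (Fin n) K)) (i : ℤ) : FiniteDimensional K (quotPiece Q i) := by
  unfold quotPiece
  infer_instance

/-- The Hilbert function of `R ⧸ Q`. -/
def hilb (Q : Ideal (MvPolynomial (Fin n) K)) (i : ℤ) : ℤ := Module.finrank K (quotPiece Q i)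

theorem mem_quotPiece {Q : Ideal (MvPolynomial (Fin n) K)} {i : ℤ}
    {x : MvPolynomial (Fin n) K ⧸ Q} :
    x ∈ quotPiece Q i ↔ ∃ p ∈ homPiece K n i, Ideal.Quotient.mk Q p = x := Iff.rfl

theorem map_factor_quotPiece {Q Q' : Ideal (MvPolynomial (Fin n) K)} (h : Q ≤ Q') (i : ℤ) :
    (quotPiece Q i).map (Ideal.Quotient.factorₐ K h).toLinearMap = quotPiece Q' i := by
  rw [quotPiece, quotPiece, ← Submodule.map_comp]
  rfl

theorem mk_mem_ker_factor {Q Q' : Ideal (MvPolynomial (Fin n) K)} (h : Q ≤ Q')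
    {p : MvPolynomial (Fin n) K} :
    Ideal.Quotient.mk Q p ∈ LinearMap.ker (Ideal.Quotient.factorₐ K h).toLinearMap ↔ p ∈ Q' := by
  rw [LinearMap.mem_ker]
  change Ideal.Quotient.mk Q' p = 0 ↔ _
  exact Ideal.Quotient.eq_zero_iff_mem

variable {Q : Ideal (MvPolynomial (Fin n) K)} {y : MvPolynomial (Fin n) K}

theorem IsRegOn.injective_mulLeft (h : IsRegOn y Q) :
    Function.Injective (LinearMap.mulLeft K (Ideal.Quotient.mk Q y)) := by
  rw [← LinearMap.ker_eq_bot, LinearMap.ker_eq_bot']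
  intro x hx
  obtain ⟨x, rfl⟩ := Ideal.Quotient.mk_surjective x
  rw [LinearMap.mulLeft_apply, ← map_mul, Ideal.Quotient.eq_zero_iff_mem] at hx
  exact Ideal.Quotient.eq_zero_iff_mem.2 (h x hx)

/-- Rank-nullity for the exact sequence 0 → (R/Q)(-e) → R/Q → R/(Q + (y)) → 0. -/
theorem hilb_sup_span (hQ : IsHomog Q) {e : ℤ} (hy : y ∈ homPiece K n e) (hyQ : IsRegOn y Q)
    (i : ℤ) : hilb (Q ⊔ Ideal.span {y}) i = hilb Q i - hilb Q (i - e) := by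
  have hle : Q ≤ Q ⊔ Ideal.span {y} := le_sup_left
  have h1 := finrank_map_add_finrank_inf_ker (Ideal.Quotient.factorₐ K hle).toLinearMap
    (quotPiece Q i)
  have h2 : quotPiece Q i ⊓ LinearMap.ker (Ideal.Quotient.factorₐ K hle).toLinearMap =
      (quotPiece Q (i - e)).map (LinearMap.mulLeft K (Ideal.Quotient.mk Q y)) := by
    ext x
    constructor
    · rintro ⟨hx, hx'⟩
      obtain ⟨p, hp, rfl⟩ := mem_quotPiece.1 hx
      obtain ⟨t, ht, hpt⟩ := hQ.exists_of_mem_sup_span hy hp ((mk_mem_ker_factor hle).1 hx')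
      refine ⟨Ideal.Quotient.mk Q t, mem_quotPiece.2 ⟨t, ht, rfl⟩, ?_⟩
      rw [LinearMap.mulLeft_apply, ← map_mul]
      exact (Ideal.Quotient.eq.2 hpt).symm
    · rintro ⟨_, ht, rfl⟩
      obtain ⟨t, ht', rfl⟩ := mem_quotPiece.1 ht
      rw [LinearMap.mulLeft_apply, ← map_mul]
      refine ⟨mem_quotPiece.2 ⟨y * t, ?_, rfl⟩, (mk_mem_ker_factor hle).2 ?_⟩
      · have := mul_mem_homPiece hy ht'
        rwa [add_sub_cancel] at this
      · exact Ideal.mem_sup_right (Ideal.mul_mem_right _ _ (Ideal.mem_span_singleton_self y))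
  rw [map_factor_quotPiece, h2, finrank_map_of_injective hyQ.injective_mulLeft] at h1
  unfold hilb
  omega

/-- A Hilbert function is nondecreasing where multiplication by some linear form is injective. -/
theorem hilb_le_of_linear {l : MvPolynomial (Fin n) K} (hl : l ∈ homPiece K n 1) {i : ℤ}
    (h : ∀ p ∈ homPiece K n i, l * p ∈ Q → p ∈ Q) : hilb Q i ≤ hilb Q (i + 1) := by
  have h1 := finrank_map_add_finrank_inf_ker (LinearMap.mulLeft K (Ideal.Quotient.mk Q l))
    (quotPiece Q i)
  have h2 : quotPiece Q i ⊓ LinearMap.ker (LinearMap.mulLeft K (Ideal.Quotient.mk Q l)) = ⊥ := by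
    rw [eq_bot_iff]
    rintro x ⟨hx, hx'⟩
    obtain ⟨p, hp, rfl⟩ := mem_quotPiece.1 hx
    have hx' : Ideal.Quotient.mk Q l * Ideal.Quotient.mk Q p = 0 := hx'
    rw [← map_mul, Ideal.Quotient.eq_zero_iff_mem] at hx'
    exact Ideal.Quotient.eq_zero_iff_mem.2 (h p hp hx')
  rw [h2, finrank_bot, add_zero] at h1
  have h3 : (quotPiece Q i).map (LinearMap.mulLeft K (Ideal.Quotient.mk Q l)) ≤
      quotPiece Q (i + 1) := by
    rintro _ ⟨_, ht, rfl⟩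
    obtain ⟨t, ht', rfl⟩ := mem_quotPiece.1 ht
    rw [LinearMap.mulLeft_apply, ← map_mul]
    refine mem_quotPiece.2 ⟨l * t, ?_, rfl⟩
    have := mul_mem_homPiece hl ht'
    rwa [add_comm] at this
  have h4 := Submodule.finrank_mono h3
  unfold hilb
  omega

theorem homPiece_le_of_hilb_eq_zero {i : ℤ} (h : hilb Q i = 0) {p : MvPolynomial (Fin n) K}
    (hp : p ∈ homPiece K n i) : p ∈ Q := by
  have h0 : quotPiece Q i = ⊥ := Submodule.finrank_eq_zero.1 (by unfold hilb at h; omega)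
  have : Ideal.Quotient.mk Q p ∈ quotPiece Q i := mem_quotPiece.2 ⟨p, hp, rfl⟩
  rw [h0] at this
  exact Ideal.Quotient.eq_zero_iff_mem.1 this

theorem hilb_varIdeal_zero : hilb (varIdeal K n 0) = Pi.single 0 1 := by
  ext i
  rcases eq_or_ne i 0 with rfl | hi
  · have h1 : (1 : MvPolynomial (Fin n) K) ∉ varIdeal K n 0 := by
      rw [varIdeal, mem_ideal_span_X_image]
      intro h
      obtain ⟨i, -, hi⟩ := h 0 (by simp)
      simp at hi
    have h2 : quotPiece (varIdeal K n 0) 0 = K ∙ (1 : MvPolynomial (Fin n) K ⧸ varIdeal K n 0) := by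
      rw [quotPiece, show homPiece K n 0 = _ from homPiece_natCast 0, homogeneousSubmodule_zero,
        Submodule.one_eq_span, Submodule.map_span, Set.image_singleton]
      rfl
    rw [hilb, h2, finrank_span_singleton]
    · simp
    · intro h
      exact h1 (Ideal.Quotient.eq_zero_iff_mem.1 h)
  · rw [Pi.single_eq_of_ne hi, hilb, Nat.cast_eq_zero, Submodule.finrank_eq_zero, eq_bot_iff]
    intro x hx
    obtain ⟨p, hp, rfl⟩ := mem_quotPiece.1 hx
    refine Ideal.Quotient.eq_zero_iff_mem.2 ?_
    rcases lt_or_gt_of_ne hi with hi | hi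
    · rw [homPiece_of_neg hi] at hp
      rw [(Submodule.mem_bot K).1 hp]
      exact zero_mem _
    · have := mem_idealOfVars_of_mem_homPiece hi hp
      convert this using 1
      simp [varIdeal, idealOfVars, Set.image_univ]

/-- The shift operator on functions on the integers. -/
def shift : Module.End ℤ (ℤ → ℤ) := LinearMap.funLeft ℤ ℤ fun i => i - 1

theorem shift_pow_apply (e : ℕ) (a : ℤ → ℤ) (i : ℤ) : (shift ^ e) a i = a (i - e) := by
  induction e generalizing i with
  | zero => simp
  | succ e ih =>
    rw [pow_succ', Module.End.mul_apply]
    change (shift ^ e) a (i - 1) = _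
    rw [ih]
    congr 1
    push_cast
    ring

theorem hilb_sup_span_eq (hQ : IsHomog Q) {e : ℕ} (hy : y ∈ homPiece K n e) (hyQ : IsRegOn y Q) :
    hilb (Q ⊔ Ideal.span {y}) = (1 - shift ^ e) (hilb Q) := by
  ext i
  rw [hilb_sup_span hQ hy hyQ, LinearMap.sub_apply, Pi.sub_apply, shift_pow_apply]
  rfl

theorem pow_one_sub_shift_hilb_varIdeal {r : ℕ} (hr : r ≤ n) :
    ((1 - shift) ^ r) (hilb (varIdeal K n r)) = Pi.single 0 1 := by
  induction r with
  | zero => exact hilb_varIdeal_zero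
  | succ r ih =>
    have h := hilb_sup_span_eq (isHomog_varIdeal (r + 1)) (e := 1)
      (by simpa using X_mem_homPiece (K := K) ⟨r, hr⟩) (isRegOn_varIdeal hr)
    rw [varIdeal_succ hr, pow_one] at h
    rw [pow_succ, Module.End.mul_apply, ← h, ih (by omega)]

/-- With `shift` read as multiplication by t, this is the Hilbert series (1 - t)^(-n) of the
polynomial ring, without division. -/
theorem pow_one_sub_shift_hilb_bot :
    ((1 - shift) ^ n) (hilb (⊥ : Ideal (MvPolynomial (Fin n) K))) = Pi.single 0 1 := by
  rw [← varIdeal_self]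
  exact pow_one_sub_shift_hilb_varIdeal le_rfl

end HilbertFunction

/-! ### Symmetry and unimodality of the coefficients of (1 + t + ⋯ + t^(d-1))^m -/

section Coefficients

/-- The coefficients of `(1 + t + ⋯ + t ^ (d - 1)) ^ m`. -/
def gaussCoeff (d m : ℕ) : ℤ → ℤ :=
  ((∑ t ∈ Finset.range d, shift ^ t) ^ m) (Pi.single 0 1)

/-- Turns the Hilbert series of a complete intersection of m forms of degree d in m + 1 variables,
cut by a linear form, into a polynomial. -/
theorem one_sub_shift_mul_pow (d m : ℕ) :
    (1 - shift) * (1 - shift ^ d) ^ m =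
      (∑ t ∈ Finset.range d, shift ^ t) ^ m * (1 - shift) ^ (m + 1) := by
  have hc : Commute (∑ t ∈ Finset.range d, shift ^ t) (1 - shift) :=
    (Commute.one_right _).sub_right
      (Commute.sum_left _ _ _ fun t _ => Commute.pow_self shift t)
  rw [← geom_sum_mul_neg, hc.mul_pow, ← mul_assoc, (hc.symm.pow_right m).eq, mul_assoc,
    ← pow_succ']

theorem gaussCoeff_zero (d : ℕ) (i : ℤ) : gaussCoeff d 0 i = if i = 0 then 1 else 0 := by
  simp [gaussCoeff, Pi.single_apply]

theorem gaussCoeff_succ (d m : ℕ) (i : ℤ) :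
    gaussCoeff d (m + 1) i = ∑ t ∈ Finset.range d, gaussCoeff d m (i - t) := by
  rw [gaussCoeff, pow_succ', Module.End.mul_apply, LinearMap.sum_apply, Finset.sum_apply]
  simp only [shift_pow_apply]
  rfl

theorem gaussCoeff_of_neg {d m : ℕ} {i : ℤ} (hi : i < 0) : gaussCoeff d m i = 0 := by
  induction m generalizing i with
  | zero => rw [gaussCoeff_zero, if_neg hi.ne]
  | succ m ih =>
    rw [gaussCoeff_succ]
    exact Finset.sum_eq_zero fun t _ => ih (by omega)

theorem gaussCoeff_symm {d m : ℕ} (i : ℤ) :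
    gaussCoeff d m (m * (d - 1) - i) = gaussCoeff d m i := by
  induction m generalizing i with
  | zero => simp [gaussCoeff_zero]
  | succ m ih =>
    rw [gaussCoeff_succ, gaussCoeff_succ, ← Finset.sum_range_reflect]
    refine Finset.sum_congr rfl fun t ht => ?_
    rw [← ih (i - t)]
    congr 1
    have := Finset.mem_range.1 ht
    push_cast [Nat.sub_sub, Nat.cast_sub (show 1 + t ≤ d by omega)]
    ring

theorem gaussCoeff_of_gt {d m : ℕ} {i : ℤ} (hi : m * ((d : ℤ) - 1) < i) :
    gaussCoeff d m i = 0 := by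
  rw [← gaussCoeff_symm]
  exact gaussCoeff_of_neg (by omega)

/-- Multiplication by 1 - t telescopes one factor. Monotonicity for m + 1 factors thereby becomes a
comparison of two values for m factors. -/
theorem gaussCoeff_succ_sub {d m : ℕ} (i : ℤ) :
    gaussCoeff d (m + 1) i - gaussCoeff d (m + 1) (i - 1) =
      gaussCoeff d m i - gaussCoeff d m (i - d) := by
  rw [gaussCoeff_succ, gaussCoeff_succ, ← Finset.sum_sub_distrib]
  have := Finset.sum_range_sub' (fun t : ℕ => gaussCoeff d m (i - t)) d
  rw [Nat.cast_zero, sub_zero] at this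
  rw [← this]
  refine Finset.sum_congr rfl fun t _ => ?_
  congr 2
  push_cast
  ring

theorem gaussCoeff_nonneg (d m : ℕ) (i : ℤ) : 0 ≤ gaussCoeff d m i := by
  induction m generalizing i with
  | zero => rw [gaussCoeff_zero]; split_ifs <;> simp
  | succ m ih =>
    rw [gaussCoeff_succ]
    exact Finset.sum_nonneg fun t _ => ih _

theorem le_of_forall_pred_le {a : ℤ → ℤ} {c : ℤ} (h : ∀ i, 2 * i ≤ c + 1 → a (i - 1) ≤ a i)
    {x y : ℤ} (hxy : x ≤ y) (hy : 2 * y ≤ c + 1) : a x ≤ a y := by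
  induction y, hxy using Int.leInduction with
  | base => exact le_rfl
  | succ y hxy ih =>
    have := h (y + 1) hy
    rw [add_sub_cancel_right] at this
    exact (ih (by omega)).trans this

/-- The coefficients decrease with the distance from the middle. -/
theorem gaussCoeff_le {d m : ℕ} {x y : ℤ} (hxy : x ≤ y)
    (h : x + y ≤ m * ((d : ℤ) - 1)) : gaussCoeff d m x ≤ gaussCoeff d m y := by
  induction m generalizing x y with
  | zero =>
    rcases lt_or_ge x 0 with hx | hx
    · rw [gaussCoeff_of_neg hx]
      exact gaussCoeff_nonneg _ _ _
    · rw [Nat.cast_zero, zero_mul] at h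
      rw [show x = y by omega]
  | succ m ih =>
    have hstep : ∀ i, 2 * i ≤ ((m + 1 : ℕ) : ℤ) * ((d : ℤ) - 1) + 1 →
        gaussCoeff d (m + 1) (i - 1) ≤ gaussCoeff d (m + 1) i := by
      intro i hi
      rw [← sub_nonneg, gaussCoeff_succ_sub, sub_nonneg]
      push_cast at hi
      exact ih (by omega) (by linarith)
    rcases le_or_gt (2 * y) (((m + 1 : ℕ) : ℤ) * ((d : ℤ) - 1) + 1) with hy | hy
    · exact le_of_forall_pred_le hstep hxy hy
    · rw [← gaussCoeff_symm y]
      exact le_of_forall_pred_le hstep (by linarith) (by linarith)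

theorem gaussCoeff_one {d : ℕ} {i : ℤ} (hi : 0 ≤ i) (hi' : i < d) : gaussCoeff d 1 i = 1 := by
  obtain ⟨c, rfl⟩ := Int.eq_ofNat_of_zero_le hi
  rw [gaussCoeff_succ, Finset.sum_eq_single c]
  · simp [gaussCoeff_zero]
  · intro t _ ht
    rw [gaussCoeff_zero, if_neg (by omega)]
  · intro h
    exact absurd (Finset.mem_range.2 (by omega)) h

/-- The coefficients increase strictly up to the middle. -/
theorem gaussCoeff_pred_lt {d m : ℕ} (hd : 1 ≤ d) (hm : 2 ≤ m) {i : ℤ} (hi : 0 ≤ i)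
    (h : 2 * i ≤ m * ((d : ℤ) - 1)) : gaussCoeff d m (i - 1) < gaussCoeff d m i := by
  induction m, hm using Nat.le_induction generalizing i with
  | base =>
    rw [← sub_pos, gaussCoeff_succ_sub]
    push_cast at h
    rw [gaussCoeff_one hi (by omega), gaussCoeff_of_neg (by omega)]
    simp
  | succ m hm ih =>
    rw [← sub_pos, gaussCoeff_succ_sub, sub_pos]
    have hd' : (0 : ℤ) ≤ (d : ℤ) - 1 := by omega
    have hm' : 2 * ((d : ℤ) - 1) ≤ m * ((d : ℤ) - 1) :=
      mul_le_mul_of_nonneg_right (by exact_mod_cast hm) hd'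
    push_cast at h
    rw [add_mul, one_mul] at h
    rcases le_or_gt (2 * i) (m * ((d : ℤ) - 1)) with hi' | hi'
    · exact (gaussCoeff_le (by omega) (by omega)).trans_lt (ih hi hi')
    -- Here i is past the middle for m factors and is reflected; the hypothesis says exactly that i
    -- - d ≤ m(d-1) - i - 1, the predecessor of the reflection.
    · rw [← gaussCoeff_symm i]
      refine lt_of_le_of_lt ?_ (ih (i := m * ((d : ℤ) - 1) - i) (by omega) (by omega))
      exact gaussCoeff_le (by omega) (by omega)

end Coefficients

/-! ### Duality in graded Artinian rings with one-dimensional socle -/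

section Duality

variable {K : Type*} [Field K] {n : ℕ} {Q : Ideal (MvPolynomial (Fin n) K)}

theorem pow_idealOfVars_le_of_homPiece_le {N : ℕ}
    (h : ∀ i : ℤ, (N : ℤ) ≤ i → ∀ p ∈ homPiece K n i, p ∈ Q) : idealOfVars (Fin n) K ^ N ≤ Q := by
  intro p hp
  refine mem_of_comp_mem fun i => ?_
  rcases le_or_gt (N : ℤ) i with hi | hi
  · exact h i hi _ (comp_mem _ _)
  · have : comp i p = 0 := by
      rcases homPiece_cases (comp_mem i p) with h0 | ⟨c, rfl, -⟩
      · exact h0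
      · unfold comp
        rw [if_pos (by omega), Int.toNat_natCast]
        refine homogeneousComponent_eq_zero' _ _ fun x hx => ?_
        have := (mem_pow_idealOfVars_iff N p).1 hp x hx
        omega
    rw [this]
    exact zero_mem _

theorem exists_pow_le_sup_span_pow {l : MvPolynomial (Fin n) K} {a : ℕ}
    (h : idealOfVars (Fin n) K ^ a ≤ Q ⊔ Ideal.span {l}) (N : ℕ) :
    ∃ b, idealOfVars (Fin n) K ^ b ≤ Q ⊔ Ideal.span {l ^ N} := by
  refine Ideal.exists_pow_le_of_le_radical_of_fg ?_ (idealOfVars_fg _ _)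
  intro x hx
  have h1 : Q ⊔ Ideal.span {l} ≤ (Q ⊔ Ideal.span {l ^ N}).radical := by
    refine sup_le (le_sup_left.trans Ideal.le_radical) ?_
    rw [Ideal.span_singleton_le_iff_mem]
    exact ⟨N, Ideal.mem_sup_right (Ideal.mem_span_singleton_self _)⟩
  have h2 : x ^ a ∈ (Q ⊔ Ideal.span {l ^ N}).radical := h1 (h (Ideal.pow_mem_pow hx a))
  exact Ideal.mem_radical_of_pow_mem h2

/-- A homogeneous element outside `Q` has a homogeneous multiple of socle degree outside `Q`. -/
theorem SocleLine.exists_mul_notMem (hQ : IsHomog Q) {σ : ℤ} (h : SocleLine σ Q) {N : ℕ}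
    (hN : idealOfVars (Fin n) K ^ N ≤ Q) {i : ℤ} {x : MvPolynomial (Fin n) K}
    (hx : x ∈ homPiece K n i) (hxQ : x ∉ Q) :
    i ≤ σ ∧ ∃ y ∈ homPiece K n (σ - i), y * x ∉ Q := by
  have key : ∀ (t : ℕ) (i : ℤ) (x : MvPolynomial (Fin n) K), x ∈ homPiece K n i → x ∉ Q →
      (∀ q ∈ idealOfVars (Fin n) K ^ t, q * x ∈ Q) →
        i ≤ σ ∧ ∃ y ∈ homPiece K n (σ - i), y * x ∉ Q := by
    intro t
    induction t with
    | zero =>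
      intro i x _ hxQ hq
      exact absurd (by simpa using hq 1 (by simp)) hxQ
    | succ t ih =>
      intro i x hx hxQ hq
      by_cases hX : ∀ j, X j * x ∈ Q
      · obtain ⟨s, hs, -, -, hline⟩ := h
        obtain ⟨c, hc⟩ := hline x hX
        have hiσ : i = σ := by
          by_contra hne
          have h1 := hQ _ hc i
          rw [map_sub, comp_self hx, ← smul_eq_C_mul, map_smul, comp_of_mem hs, if_neg hne,
            smul_zero, sub_zero] at h1
          exact hxQ h1
        subst hiσ
        refine ⟨le_rfl, 1, ?_, by rwa [one_mul]⟩
        rw [sub_self]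
        exact mem_homPiece_natCast.2 (isHomogeneous_one (Fin n) K)
      · push Not at hX
        obtain ⟨j, hj⟩ := hX
        obtain ⟨h1, y, hy, hyx⟩ := ih (1 + i) (X j * x) (mul_mem_homPiece (X_mem_homPiece j) hx) hj
          fun q hq' => by
            rw [← mul_assoc]
            exact hq _ (by
              rw [pow_succ]
              exact Ideal.mul_mem_mul hq' (Ideal.subset_span ⟨j, rfl⟩))
        refine ⟨by omega, y * X j, ?_, by rwa [mul_assoc]⟩
        have := mul_mem_homPiece hy (X_mem_homPiece j)
        rwa [show σ - (1 + i) + 1 = σ - i by ring] at this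
  exact key N i x hx hxQ fun q hq => Ideal.mul_mem_right _ _ (hN hq)

/-- Duality for a graded Artinian ring with one-dimensional socle: a homogeneous element outside
an ideal `I` is separated from `I` by a multiplier annihilating `I`. -/
theorem SocleLine.exists_separating (hQ : IsHomog Q) {σ : ℤ} (h : SocleLine σ Q) {N : ℕ}
    (hN : idealOfVars (Fin n) K ^ N ≤ Q) {I : Ideal (MvPolynomial (Fin n) K)} (hQI : Q ≤ I)
    {j : ℤ} {x : MvPolynomial (Fin n) K} (hx : x ∈ homPiece K n j) (hxI : x ∉ I) :
    ∃ y ∈ homPiece K n (σ - j), y * x ∉ Q ∧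
      ∀ (i : ℤ), ∀ p ∈ homPiece K n i, p ∈ I → y * p ∈ Q := by
  obtain ⟨s, hs, hsQ, -, hline⟩ := id h
  obtain ⟨lam, hlam, hlamQ⟩ :=
    Submodule.exists_dual_map_eq_bot_of_notMem (p := Q.restrictScalars K) hsQ inferInstance
  have hlamQ : ∀ q ∈ Q, lam q = 0 := fun q hq => by
    have : lam q ∈ (Q.restrictScalars K).map lam := ⟨q, hq, rfl⟩
    rwa [hlamQ, Submodule.mem_bot] at this
  -- Nothing survives modulo `Q` above degree σ, so a form of degree σ is a socle element, hence a
  -- multiple of `s` modulo `Q`, and `lam` detects the multiple.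
  have hker : ∀ q ∈ homPiece K n σ, lam q = 0 → q ∈ Q := by
    intro q hq hq0
    obtain ⟨c, hc⟩ := hline q fun i => by
      by_contra hXq
      have := (h.exists_mul_notMem hQ hN (mul_mem_homPiece (X_mem_homPiece i) hq) hXq).1
      omega
    have h1 := hlamQ _ hc
    rw [map_sub, hq0, ← smul_eq_C_mul, map_smul, zero_sub, neg_eq_zero, smul_eq_mul,
      mul_eq_zero, or_iff_left hlam] at h1
    simpa [h1] using hc
  let Φ : MvPolynomial (Fin n) K →ₗ[K] Module.Dual K (homPiece K n (σ - j)) :=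
    ((LinearMap.mul K (MvPolynomial (Fin n) K)).compr₂ lam).compl₂ (homPiece K n (σ - j)).subtype
  have hΦ : ∀ p y, Φ p y = lam (p * y) := fun p y => rfl
  have hnot : Φ x ∉ (homPiece K n j ⊓ I.restrictScalars K).map Φ := by
    rintro ⟨p, ⟨hp, hpI⟩, hpx⟩
    refine hxI ?_
    have hdiff : x - p ∈ Q := by
      by_contra hne
      obtain ⟨-, y, hy, hyx⟩ := h.exists_mul_notMem hQ hN (sub_mem hx hp) hne
      refine hyx (hker _ ?_ ?_)
      · have := mul_mem_homPiece hy (sub_mem hx hp)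
        rwa [sub_add_cancel] at this
      · have := LinearMap.congr_fun hpx ⟨y, hy⟩
        rw [hΦ, hΦ] at this
        rw [mul_sub, map_sub, mul_comm y, mul_comm y, sub_eq_zero]
        exact this.symm
    have := I.add_mem (hQI hdiff) hpI
    rwa [sub_add_cancel] at this
  -- A functional separates `Φ x` from the image of the degree j part of `I`; by finite-dimensional
  -- reflexivity it is evaluation at some `y` of degree σ - j.
  obtain ⟨E, hE, hE0⟩ := Submodule.exists_dual_map_eq_bot_of_notMem hnot inferInstance
  obtain ⟨y, rfl⟩ := (Module.evalEquiv K (homPiece K n (σ - j))).surjective E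
  have hE0' : ∀ p ∈ homPiece K n j, p ∈ I → lam (p * y) = 0 := fun p hp hpI => by
    have : Module.evalEquiv K _ y (Φ p) ∈ ((homPiece K n j ⊓ I.restrictScalars K).map Φ).map
      (Module.evalEquiv K (homPiece K n (σ - j)) y) := ⟨Φ p, ⟨p, ⟨hp, hpI⟩, rfl⟩, rfl⟩
    rw [hE0, Submodule.mem_bot] at this
    exact this
  refine ⟨y, y.2, fun hmem => hE ?_, fun i p hp hpI => ?_⟩
  · change lam (x * y) = 0
    rw [mul_comm]
    exact hlamQ _ hmem
  -- Only degree j was used to choose `y`. If `y * p` were nonzero modulo `Q`, a multiple of it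
  -- would reach degree σ; but the same multiple of `p` lies in `I` in degree j, where `y` pairs to
  -- zero.
  · by_contra hne
    obtain ⟨-, v, hv, hvy⟩ := h.exists_mul_notMem hQ hN (mul_mem_homPiece y.2 hp) hne
    have hvp := mul_mem_homPiece hv hp
    rw [show σ - (σ - j + i) + i = j by ring] at hvp
    refine hvy ?_
    rw [mul_left_comm]
    refine hker _ ?_ ?_
    · have := mul_mem_homPiece y.2 hvp
      rwa [sub_add_cancel] at this
    · rw [mul_comm]
      exact hE0' _ hvp (I.mul_mem_left _ hpI)

end Duality

/-! ### General parameters, and annihilators of ideals of dimension at most one -/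

section GenericChoice

variable {K : Type*} [Field K] {n : ℕ}

-- The homogeneous core of a prime is prime. Radicals of homogeneous ideals can thus be tested on
-- homogeneous primes, which all lie in 𝔪.
attribute [local instance] MvPolynomial.gradedAlgebra in
theorem exists_homog_prime_le (P : Ideal (MvPolynomial (Fin n) K)) [P.IsPrime] :
    ∃ P' : Ideal (MvPolynomial (Fin n) K), P'.IsPrime ∧ IsHomog P' ∧ P' ≤ P ∧
      ∀ I : Ideal (MvPolynomial (Fin n) K), IsHomog I → I ≤ P → I ≤ P' := by
  refine ⟨(P.homogeneousCore (homogeneousSubmodule (Fin n) K)).toIdeal,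
    Ideal.IsPrime.homogeneousCore ‹_›, fun p hp i => ?_, Ideal.toIdeal_homogeneousCore_le _ _,
    fun I hI hIP p hp => mem_of_comp_mem fun i => ?_⟩
  · unfold comp
    split_ifs
    · exact homogeneousComponent_mem_of_mem (HomogeneousIdeal.isHomogeneous _) hp _
    · exact zero_mem _
  · rcases homPiece_cases (comp_mem i p) with h0 | ⟨c, -, hc⟩
    · rw [h0]; exact zero_mem _
    · exact Ideal.mem_homogeneousCore_of_homogeneous_of_mem
        ⟨c, (mem_homogeneousSubmodule c _).2 hc⟩ (hIP (hI p hp i))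

theorem IsHomog.le_idealOfVars {P : Ideal (MvPolynomial (Fin n) K)} (hP : IsHomog P)
    (hne : P ≠ ⊤) : P ≤ idealOfVars (Fin n) K := by
  intro p hp
  rw [← pow_one (idealOfVars _ _), mem_pow_idealOfVars_iff']
  intro x hx
  have hx0 : x = 0 := (Finsupp.degree_eq_zero_iff x).1 (by omega)
  subst hx0
  by_contra hcoeff
  have h0 : C (coeff 0 p) ∈ P := by
    have := hP p hp 0
    simpa [comp] using this
  exact hne (Ideal.eq_top_of_isUnit_mem _ h0 ((isUnit_iff_ne_zero.2 hcoeff).map C))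

theorem idealOfVars_ne_top : idealOfVars (Fin n) K ≠ ⊤ := by
  rw [Ne, Ideal.eq_top_iff_one, ← pow_one (idealOfVars _ _), mem_pow_idealOfVars_iff']
  intro h
  simpa using h 0 (by simp)

/-- The condition that `R ⧸ I` has dimension at most one. -/
def DimLEOne {A : Type*} [CommRing A] (I : Ideal A) : Prop :=
  ∀ P P' : Ideal A, P.IsPrime → P'.IsPrime → I ≤ P → P < P' → P'.IsMaximal

/-- A general linear form is a parameter modulo `I`. -/
theorem exists_linear_parameter [Infinite K] {I : Ideal (MvPolynomial (Fin n) K)}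
    (hI : IsHomog I) (hdim : DimLEOne I) {s : Set (Ideal (MvPolynomial (Fin n) K))}
    (hs : s.Finite) (hfree : ∀ Q ∈ s, SocleFree Q) :
    ∃ z ∈ homPiece K n 1, (∀ Q ∈ s, IsRegOn z Q) ∧
      ∃ t, idealOfVars (Fin n) K ^ t ≤ I ⊔ Ideal.span {z} := by
  obtain ⟨z, hz, hreg⟩ := exists_linear_isRegOn
    (s := s ∪ {P ∈ I.minimalPrimes | ¬ idealOfVars (Fin n) K ≤ P})
    (hs.union ((I.finite_minimalPrimes_of_isNoetherianRing _).subset fun _ h => h.1)) (by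
      rintro P (hP | ⟨hP, hmP⟩)
      · exact hfree P hP
      · intro x hx
        have := hP.1.1
        by_contra hxP
        refine hmP (Ideal.span_le.2 ?_)
        rintro _ ⟨i, rfl⟩
        exact (this.mem_or_mem (hx i)).resolve_right hxP)
  refine ⟨z, hz, fun Q hQ => hreg Q (Or.inl hQ), ?_⟩
  refine Ideal.exists_pow_le_of_le_radical_of_fg ?_ (idealOfVars_fg _ _)
  rw [Ideal.radical_eq_sInf]
  refine le_sInf ?_
  rintro P ⟨hIP, hP⟩
  -- The core `P'` still contains I + (z). A minimal prime `P₀` of I below it either contains 𝔪 or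
  -- misses z; in the second case `P₀ < P'`, so `P'` is maximal, and being inside 𝔪 it equals 𝔪.
  obtain ⟨P', hP', hhom, hle, hP'max⟩ := exists_homog_prime_le P
  have hIP' := hP'max _ (hI.sup_span hz) hIP
  obtain ⟨P₀, hP₀, hP₀P'⟩ := Ideal.exists_minimalPrimes_le (le_sup_left.trans hIP')
  refine le_trans ?_ hle
  by_cases hm : idealOfVars (Fin n) K ≤ P₀
  · exact hm.trans hP₀P'
  · have hzP₀ : z ∉ P₀ := fun hzP => hP₀.1.1.ne_top ((Ideal.eq_top_iff_one _).2
      (hreg P₀ (Or.inr ⟨hP₀, hm⟩) 1 (by rwa [mul_one])))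
    have hlt : P₀ < P' := lt_of_le_of_ne hP₀P' fun h => hzP₀ (h ▸ hIP'
      (Ideal.mem_sup_right (Ideal.mem_span_singleton_self z)))
    have hmax := hdim P₀ P' hP₀.1.1 hP' hP₀.1.2 hlt
    exact (hmax.eq_of_le idealOfVars_ne_top (hhom.le_idealOfVars hP'.ne_top)).ge

theorem SocleFree.of_pow {Q : Ideal (MvPolynomial (Fin n) K)} (h : SocleFree Q) {t : ℕ}
    {x : MvPolynomial (Fin n) K} (hx : ∀ q ∈ idealOfVars (Fin n) K ^ t, q * x ∈ Q) : x ∈ Q := by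
  induction t generalizing x with
  | zero => simpa using hx 1 (by simp)
  | succ t ih =>
    refine h x fun i => ih fun q hq => ?_
    rw [← mul_assoc]
    refine hx _ ?_
    rw [pow_succ]
    exact Ideal.mul_mem_mul hq (Ideal.subset_span ⟨i, rfl⟩)

/-- In depth at least two, no nonzero element is killed by an ideal of dimension at most one. -/
theorem GorSocle.mem_of_mul_mem [Infinite K] {ι : Type*} [Fintype ι] {r : ℕ} {σ d : ℤ}
    {Q : Ideal (MvPolynomial (Fin n) K)} (hQ : IsHomog Q) (h : GorSocle (r + 2) σ Q)
    {F : ι → MvPolynomial (Fin n) K} (hF : ∀ i, F i ∈ homPiece K n d)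
    (hdim : DimLEOne (Ideal.span (Set.range F))) {x : MvPolynomial (Fin n) K}
    (hx : ∀ i, F i * x ∈ Q) : x ∈ Q := by
  obtain ⟨z, hz, hzQ, t, ht⟩ := exists_linear_parameter (isHomog_span_range hF) hdim
    (s := {Q}) (Set.finite_singleton Q) (by rintro _ rfl; exact h.socleFree)
  have hzQ := hzQ Q rfl
  have hfree := (h.exchange hQ one_pos hz hzQ).socleFree
  have hspan : ∀ x, (∀ i, F i * x ∈ Q) → ∀ p ∈ Ideal.span (Set.range F), p * x ∈ Q := by
    intro x hx p hp
    have : Ideal.span (Set.range F) ≤ Submodule.comap (LinearMap.toSpanSingleton _ _ x) Q := by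
      rw [Ideal.span_le]
      rintro _ ⟨i, rfl⟩
      exact hx i
    exact this hp
  -- Modulo Q + (z), x is killed by the ideal of F and hence by a power of 𝔪; the remaining depth
  -- makes x divisible by z. The quotient is again killed by F, which starts a descent on degree.
  have hstep : ∀ (c : ℤ) (x), x ∈ homPiece K n c → (∀ i, F i * x ∈ Q) →
      ∃ x' ∈ homPiece K n (c - 1), x - z * x' ∈ Q ∧ ∀ i, F i * x' ∈ Q := by
    intro c x hxc hx
    obtain ⟨x', hx', hxx'⟩ := hQ.exists_of_mem_sup_span hz hxc (hfree.of_pow (t := t)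
      fun q hq => by
        obtain ⟨s, hs⟩ := mem_sup_span_singleton.1 (ht hq)
        refine mem_sup_span_singleton.2 ⟨s * x, ?_⟩
        have := hspan x hx _ hs
        rwa [sub_mul, mul_assoc] at this)
    refine ⟨x', hx', hxx', fun i => hzQ _ ?_⟩
    have := Q.sub_mem (hx i) (Q.mul_mem_left (F i) hxx')
    convert this using 1
    ring
  have key : ∀ (c : ℕ) (x), x ∈ homPiece K n (c : ℤ) → (∀ i, F i * x ∈ Q) → x ∈ Q := by
    intro c
    induction c with
    | zero =>
      intro x hxc hx
      obtain ⟨x', hx', hxx', -⟩ := hstep _ x hxc hx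
      rw [homPiece_of_neg (by simp), Submodule.mem_bot] at hx'
      simpa [hx'] using hxx'
    | succ c ih =>
      intro x hxc hx
      obtain ⟨x', hx', hxx', hFx'⟩ := hstep _ x hxc hx
      have := Q.add_mem hxx' (Q.mul_mem_left z (ih x' (by simpa using hx') hFx'))
      rwa [sub_add_cancel] at this
  refine mem_of_comp_mem fun j => ?_
  rcases homPiece_cases (comp_mem j x) with h0 | ⟨c, rfl, hc⟩
  · rw [h0]; exact zero_mem _
  · refine key c _ (comp_mem _ _) fun i => ?_
    have := hQ _ (hx i) (c + d)
    rwa [comp_mul (hF i), add_sub_cancel_right] at this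

end GenericChoice

/-! ### Koszul syzygies through alternating matrices -/

section Koszul

open Matrix

variable {A : Type*} [CommRing A] {ι κ : Type*} [Fintype ι] [Fintype κ]

/-- The Koszul syzygies of a family `F`, given by alternating matrices `b - bᵀ`. -/
def koszul (F : ι → A) : Submodule A (ι → A) :=
  LinearMap.range (((Matrix.mulVecBilin A A).flip F) ∘ₗ
    (LinearMap.id - (Matrix.transposeLinearEquiv ι ι A A).toLinearMap))

theorem mem_koszul {F u : ι → A} : u ∈ koszul F ↔ ∃ b : Matrix ι ι A, (b - bᵀ) *ᵥ F = u := Iff.rfl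

/-- Congruence preserves the form b - bᵀ: b is replaced by PᵀbP. -/
theorem vecMul_mem_koszul {F : ι → A} (P : Matrix κ ι A) {u : κ → A}
    (h : u ∈ koszul (P *ᵥ F)) : u ᵥ* P ∈ koszul F := by
  obtain ⟨b, rfl⟩ := mem_koszul.1 h
  refine mem_koszul.2 ⟨Pᵀ * b * P, ?_⟩
  rw [← Matrix.mulVec_transpose, Matrix.mulVec_mulVec, Matrix.mulVec_mulVec]
  congr 1
  simp only [Matrix.transpose_mul, Matrix.transpose_transpose, Matrix.mul_sub, Matrix.sub_mul,
    Matrix.mul_assoc]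

/-- All syzygies are Koszul syzygies. -/
def KoszulExact (F : ι → A) : Prop := ∀ u : ι → A, u ⬝ᵥ F = 0 → u ∈ koszul F

/-- Koszul relations between y and the g i clear the entry at y; what remains is a syzygy of g. -/
theorem cons_mem_koszul {r : ℕ} {g : Fin r → A} (hg : KoszulExact g) {y : A} {u : Fin (r + 1) → A}
    (hu : u ⬝ᵥ (Fin.cons y g : Fin (r + 1) → A) = 0) (h0 : u 0 ∈ Ideal.span (Set.range g)) :
    u ∈ koszul (Fin.cons y g : Fin (r + 1) → A) := by
  obtain ⟨c, hc⟩ := Ideal.mem_span_range_iff_exists_fun.1 h0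
  obtain ⟨b, hb⟩ := mem_koszul.1 (hg (fun i => u i.succ + c i * y) (by
    simp only [dotProduct, Fin.sum_univ_succ, Fin.cons_zero, Fin.cons_succ] at hu
    simp only [dotProduct, add_mul, Finset.sum_add_distrib]
    rw [← hc, Finset.sum_mul] at hu
    rw [← hu, add_comm]
    congr 1
    exact Finset.sum_congr rfl fun i _ => by ring))
  refine mem_koszul.2 ⟨Matrix.of (Fin.cons (Fin.cons 0 c) fun i => Fin.cons 0 (b i)), ?_⟩
  ext i
  refine Fin.cases ?_ (fun i => ?_) i
  · simp [Matrix.mulVec, dotProduct, Fin.sum_univ_succ, hc]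
  · have := congrFun hb i
    simp only [Matrix.mulVec, dotProduct, Matrix.sub_apply, Matrix.transpose_apply] at this
    simp [Matrix.mulVec, dotProduct, Fin.sum_univ_succ, this]

theorem KoszulExact.cons {r : ℕ} {g : Fin r → A} (hg : KoszulExact g) {y : A}
    (hy : IsRegOn y (Ideal.span (Set.range g))) :
    KoszulExact (Fin.cons y g : Fin (r + 1) → A) := by
  intro u hu
  refine cons_mem_koszul hg hu (hy _ ?_)
  simp only [dotProduct, Fin.sum_univ_succ, Fin.cons_zero, Fin.cons_succ] at hu
  rw [mul_comm, eq_neg_of_add_eq_zero_left hu]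
  exact neg_mem (sum_mem fun i _ => Ideal.mul_mem_left _ _ (Ideal.subset_span ⟨i, rfl⟩))

theorem span_range_finCons {r : ℕ} (y : A) (g : Fin r → A) :
    Ideal.span (Set.range (Fin.cons y g : Fin (r + 1) → A)) =
      Ideal.span (Set.range g) ⊔ Ideal.span {y} := by
  rw [Fin.range_cons, Ideal.span_insert, sup_comm]

variable {r : ℕ} {g : Fin r → A} {a b : A}

/-- Here ρ is the coefficient of the relation between a and b; relations with g clear what is left
of the first two entries. Together with `exists_of_cons_cons_mem_koszul` this reduces H₁(a, b, g; A)
to H₁(a, b; A/(g)). -/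
theorem cons_cons_mem_koszul (hg : KoszulExact g) {u : Fin (r + 2) → A} {ρ : A}
    (hu : u ⬝ᵥ (Fin.cons a (Fin.cons b g) : Fin (r + 2) → A) = 0)
    (h0 : u 0 - ρ * b ∈ Ideal.span (Set.range g)) (h1 : u 1 + ρ * a ∈ Ideal.span (Set.range g)) :
    u ∈ koszul (Fin.cons a (Fin.cons b g) : Fin (r + 2) → A) := by
  obtain ⟨c, hc⟩ := Ideal.mem_span_range_iff_exists_fun.1 h0
  obtain ⟨c', hc'⟩ := Ideal.mem_span_range_iff_exists_fun.1 h1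
  obtain ⟨B, hB⟩ := mem_koszul.1 (hg (fun i => u i.succ.succ + c i * a + c' i * b) (by
    simp only [dotProduct, Fin.sum_univ_succ, Fin.cons_zero, Fin.cons_succ] at hu
    simp only [dotProduct, add_mul, Finset.sum_add_distrib]
    have e1 : ∑ i, c i * a * g i = (u 0 - ρ * b) * a := by
      rw [← hc, Finset.sum_mul]
      exact Finset.sum_congr rfl fun i _ => by ring
    have e2 : ∑ i, c' i * b * g i = (u 1 + ρ * a) * b := by
      rw [← hc', Finset.sum_mul]
      exact Finset.sum_congr rfl fun i _ => by ring
    rw [e1, e2]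
    have : u (Fin.succ 0) = u 1 := rfl
    rw [this] at hu
    linear_combination hu))
  refine mem_koszul.2 ⟨Matrix.of (Fin.cons (Fin.cons 0 (Fin.cons ρ c))
    (Fin.cons (Fin.cons 0 (Fin.cons 0 c')) fun i => Fin.cons 0 (Fin.cons 0 (B i)))), ?_⟩
  ext i
  refine Fin.cases ?_ (fun i => Fin.cases ?_ (fun i => ?_) i) i
  · simp [Matrix.mulVec, dotProduct, Fin.sum_univ_succ, hc]
  · simp [Matrix.mulVec, dotProduct, Fin.sum_univ_succ, hc']
  · have := congrFun hB i
    simp only [Matrix.mulVec, dotProduct, Matrix.sub_apply, Matrix.transpose_apply] at this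
    simp [Matrix.mulVec, dotProduct, Fin.sum_univ_succ, this]

theorem exists_of_cons_cons_mem_koszul {u : Fin (r + 2) → A}
    (hu : u ∈ koszul (Fin.cons a (Fin.cons b g) : Fin (r + 2) → A)) :
    ∃ ρ, u 0 - ρ * b ∈ Ideal.span (Set.range g) ∧ u 1 + ρ * a ∈ Ideal.span (Set.range g) := by
  obtain ⟨B, rfl⟩ := mem_koszul.1 hu
  have hsum : ∀ c : Fin r → A, ∑ i, c i * g i ∈ Ideal.span (Set.range g) := fun c =>
    sum_mem fun i _ => Ideal.mul_mem_left _ _ (Ideal.subset_span ⟨i, rfl⟩)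
  refine ⟨B 0 1 - B 1 0, ?_, ?_⟩
  · convert hsum fun i => B 0 i.succ.succ - B i.succ.succ 0 using 1
    simp [Matrix.mulVec, dotProduct, Fin.sum_univ_succ]
  · convert hsum fun i => B 1 i.succ.succ - B i.succ.succ 1 using 1
    simp [Matrix.mulVec, dotProduct, Fin.sum_univ_succ]
    ring

end Koszul

/-! ### Consequences of vanishing Koszul homology and of vanishing torsion -/

section Threshold

open Matrix

variable {K : Type*} [Field K] {n : ℕ}

/-- Syzygies with coefficients of degree at most `M` are Koszul. -/
def KoszulUpTo {ι : Type*} [Fintype ι] (F : ι → MvPolynomial (Fin n) K) (M : ℤ) : Prop :=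
  ∀ c ≤ M, ∀ u : ι → MvPolynomial (Fin n) K, (∀ i, u i ∈ homPiece K n c) → u ⬝ᵥ F = 0 →
    u ∈ koszul F

/-- Syzygies with coefficients of degree at most `M` which become Koszul after multiplication by
a power of the maximal ideal are Koszul. -/
def TorsionFreeUpTo {ι : Type*} [Fintype ι] (F : ι → MvPolynomial (Fin n) K) (M : ℤ) : Prop :=
  ∀ c ≤ M, ∀ u : ι → MvPolynomial (Fin n) K, (∀ i, u i ∈ homPiece K n c) → u ⬝ᵥ F = 0 →
    (∃ N : ℕ, ∀ q ∈ idealOfVars (Fin n) K ^ N, q • u ∈ koszul F) → u ∈ koszul F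

theorem exists_homogeneous_coeffs {ι : Type*} [Fintype ι] {g : ι → MvPolynomial (Fin n) K}
    {c d : ℤ} (hg : ∀ t, g t ∈ homPiece K n d) {w : MvPolynomial (Fin n) K}
    (hw : w ∈ homPiece K n (d + c)) (hwg : w ∈ Ideal.span (Set.range g)) :
    ∃ γ : ι → MvPolynomial (Fin n) K, (∀ t, γ t ∈ homPiece K n c) ∧ ∑ t, γ t * g t = w := by
  obtain ⟨γ, hγ⟩ := Ideal.mem_span_range_iff_exists_fun.1 hwg
  refine ⟨fun t => comp c (γ t), fun t => comp_mem _ _, ?_⟩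
  rw [← comp_self hw, ← hγ, map_sum]
  refine Finset.sum_congr rfl fun t _ => ?_
  rw [mul_comm (γ t), comp_mul (hg t), add_sub_cancel_left, mul_comm]

variable {r : ℕ} {g : Fin r → MvPolynomial (Fin n) K} {a b : MvPolynomial (Fin n) K} {d M : ℤ}

theorem exists_homogeneous_syzygy (hg : ∀ t, g t ∈ homPiece K n d) {c : ℤ}
    (ha : a ∈ homPiece K n d) (hb : b ∈ homPiece K n d) {α β : MvPolynomial (Fin n) K}
    (hα : α ∈ homPiece K n c) (hβ : β ∈ homPiece K n c)
    (h : α * a + β * b ∈ Ideal.span (Set.range g)) :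
    ∃ u : Fin (r + 2) → MvPolynomial (Fin n) K, u 0 = α ∧ u 1 = β ∧
      (∀ i, u i ∈ homPiece K n c) ∧
      u ⬝ᵥ (Fin.cons a (Fin.cons b g) : Fin (r + 2) → MvPolynomial (Fin n) K) = 0 := by
  obtain ⟨γ, hγ, hsum⟩ := exists_homogeneous_coeffs hg (c := c) (by
    rw [mul_comm α, mul_comm β]
    exact add_mem (mul_mem_homPiece ha hα) (mul_mem_homPiece hb hβ)) h
  refine ⟨Fin.cons α (Fin.cons β (-γ)), rfl, rfl, fun i => ?_, ?_⟩
  · refine Fin.cases hα (fun i => Fin.cases hβ (fun i => ?_) i) i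
    exact neg_mem (hγ i)
  · simp [dotProduct, Fin.sum_univ_succ, hsum, ← add_assoc]

theorem KoszulUpTo.exists_quotient (hg : ∀ t, g t ∈ homPiece K n d) (ha : a ∈ homPiece K n d)
    (hb : b ∈ homPiece K n d)
    (h : KoszulUpTo (Fin.cons a (Fin.cons b g) : Fin (r + 2) → MvPolynomial (Fin n) K) M) {c : ℤ}
    (hc : c ≤ M) {α β : MvPolynomial (Fin n) K} (hα : α ∈ homPiece K n c)
    (hβ : β ∈ homPiece K n c) (hαβ : α * a + β * b ∈ Ideal.span (Set.range g)) :
    ∃ ρ ∈ homPiece K n (c - d), α - ρ * b ∈ Ideal.span (Set.range g) ∧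
      β + ρ * a ∈ Ideal.span (Set.range g) := by
  obtain ⟨u, rfl, rfl, hu, hsyz⟩ := exists_homogeneous_syzygy hg ha hb hα hβ hαβ
  obtain ⟨ρ, h0, h1⟩ := exists_of_cons_cons_mem_koszul (h c hc u hu hsyz)
  have hQ := isHomog_span_range hg
  refine ⟨comp (c - d) ρ, comp_mem _ _, ?_, ?_⟩
  · have := hQ _ h0 c
    rwa [map_sub, comp_self (hu 0), mul_comm, comp_mul hb, mul_comm] at this
  · have := hQ _ h1 c
    rwa [map_add, comp_self (hu 1), mul_comm, comp_mul ha, mul_comm] at this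

/-- The pair (γ, 0) is a cycle on (a, b) modulo (g), hence γ = ρb with ρa = 0 there. Since ρ has
degree c - d, descent applies. -/
theorem KoszulUpTo.mem_of_mul_mem (hd : 0 < d) (hg : ∀ t, g t ∈ homPiece K n d)
    (ha : a ∈ homPiece K n d) (hb : b ∈ homPiece K n d)
    (h : KoszulUpTo (Fin.cons a (Fin.cons b g) : Fin (r + 2) → MvPolynomial (Fin n) K) M) {c : ℤ}
    (hc : c ≤ M) {γ : MvPolynomial (Fin n) K} (hγ : γ ∈ homPiece K n c)
    (hγa : γ * a ∈ Ideal.span (Set.range g)) : γ ∈ Ideal.span (Set.range g) := by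
  have key : ∀ (t : ℕ) (c : ℤ), c ≤ M → c < t → ∀ γ ∈ homPiece K n c,
      γ * a ∈ Ideal.span (Set.range g) → γ ∈ Ideal.span (Set.range g) := by
    intro t
    induction t with
    | zero =>
      intro c _ hct γ hγ _
      rw [homPiece_of_neg (by exact_mod_cast hct), Submodule.mem_bot] at hγ
      simp [hγ]
    | succ t ih =>
      intro c hc hct γ hγ hγa
      obtain ⟨ρ, hρ, h0, h1⟩ := h.exists_quotient hg ha hb hc hγ (zero_mem _) (by simpa using hγa)
      rw [zero_add] at h1
      have := ih (c - d) (by omega) (by push_cast at hct; omega) ρ hρ h1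
      have := add_mem h0 (Ideal.mul_mem_right b _ this)
      rwa [sub_add_cancel] at this
  exact key (c.toNat + 1) c hc (by omega) γ hγ hγa

/-- A product of submodules is equivalent to the product of the modules. -/
def prodSubmoduleEquiv {V W : Type*} [AddCommGroup V] [Module K V] [AddCommGroup W]
    [Module K W] (P : Submodule K V) (P' : Submodule K W) : P.prod P' ≃ₗ[K] P × P' where
  toFun x := (⟨x.1.1, x.2.1⟩, ⟨x.1.2, x.2.2⟩)
  invFun x := ⟨(x.1, x.2), x.1.2, x.2.2⟩
  map_add' _ _ := rfl
  map_smul' _ _ := rfl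

/-- The Hilbert function of `R ⧸ (g, a, b)` in the degrees where the Koszul complex is exact. -/
theorem KoszulUpTo.hilb_eq (hd : 0 < d) (hg : ∀ t, g t ∈ homPiece K n d)
    (ha : a ∈ homPiece K n d) (hb : b ∈ homPiece K n d)
    (h : KoszulUpTo (Fin.cons a (Fin.cons b g) : Fin (r + 2) → MvPolynomial (Fin n) K) M) {i : ℤ}
    (hi : i ≤ M + d) :
    hilb (Ideal.span (Set.range g) ⊔ Ideal.span {b} ⊔ Ideal.span {a}) i =
      hilb (Ideal.span (Set.range g)) i - 2 * hilb (Ideal.span (Set.range g)) (i - d) +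
        hilb (Ideal.span (Set.range g)) (i - d - d) := by
  set Q := Ideal.span (Set.range g) with hQdef
  have hQ : IsHomog Q := isHomog_span_range hg
  set J := Q ⊔ Ideal.span {b} ⊔ Ideal.span {a} with hJ
  have hle : Q ≤ J := le_sup_left.trans le_sup_left
  let mka := Ideal.Quotient.mk Q a
  let mkb := Ideal.Quotient.mk Q b
  -- `μ` and `ν` are the differentials of the Koszul complex of a, b over R/Q. The Hilbert function
  -- comes from rank-nullity for both and for the projection to R/J.
  let μ : (MvPolynomial (Fin n) K ⧸ Q) × (MvPolynomial (Fin n) K ⧸ Q) →ₗ[K]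
      (MvPolynomial (Fin n) K ⧸ Q) :=
    (LinearMap.mulRight K mka).coprod (LinearMap.mulRight K mkb)
  let ν : (MvPolynomial (Fin n) K ⧸ Q) →ₗ[K]
      (MvPolynomial (Fin n) K ⧸ Q) × (MvPolynomial (Fin n) K ⧸ Q) :=
    (LinearMap.mulRight K mkb).prod (-LinearMap.mulRight K mka)
  have hμ : ∀ α β, μ (Ideal.Quotient.mk Q α, Ideal.Quotient.mk Q β) =
      Ideal.Quotient.mk Q (α * a + β * b) := fun α β => by simp [μ, mka, mkb]
  have hν : ∀ γ, ν (Ideal.Quotient.mk Q γ) =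
      (Ideal.Quotient.mk Q (γ * b), Ideal.Quotient.mk Q (-(γ * a))) := fun γ => by
    simp [ν, mka, mkb]
  have hprod := prodSubmoduleEquiv (quotPiece Q (i - d)) (quotPiece Q (i - d))
  have := hprod.symm.finiteDimensional
  have e1 := finrank_map_add_finrank_inf_ker (Ideal.Quotient.factorₐ K hle).toLinearMap
    (quotPiece Q i)
  have e2 := finrank_map_add_finrank_inf_ker μ ((quotPiece Q (i - d)).prod (quotPiece Q (i - d)))
  have e3 := finrank_map_add_finrank_inf_ker ν (quotPiece Q (i - d - d))
  have s1 : quotPiece Q i ⊓ LinearMap.ker (Ideal.Quotient.factorₐ K hle).toLinearMap =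
      ((quotPiece Q (i - d)).prod (quotPiece Q (i - d))).map μ := by
    ext x
    constructor
    · rintro ⟨hx, hx'⟩
      obtain ⟨p, hp, rfl⟩ := mem_quotPiece.1 hx
      obtain ⟨α, hα, hpα⟩ := (hQ.sup_span hb).exists_of_mem_sup_span ha hp
        ((mk_mem_ker_factor hle).1 hx')
      have hp' : p - a * α ∈ homPiece K n i := by
        refine sub_mem hp ?_
        have := mul_mem_homPiece ha hα
        rwa [add_sub_cancel] at this
      obtain ⟨β, hβ, hpβ⟩ := hQ.exists_of_mem_sup_span hb hp' hpα
      refine ⟨(Ideal.Quotient.mk Q α, Ideal.Quotient.mk Q β),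
        ⟨mem_quotPiece.2 ⟨α, hα, rfl⟩, mem_quotPiece.2 ⟨β, hβ, rfl⟩⟩, ?_⟩
      rw [hμ]
      refine (Ideal.Quotient.eq.2 ?_).symm
      convert hpβ using 1
      ring
    · rintro ⟨⟨x, y⟩, ⟨hx, hy⟩, rfl⟩
      obtain ⟨α, hα, rfl⟩ := mem_quotPiece.1 hx
      obtain ⟨β, hβ, rfl⟩ := mem_quotPiece.1 hy
      rw [hμ]
      refine ⟨mem_quotPiece.2 ⟨_, ?_, rfl⟩, (mk_mem_ker_factor hle).2 ?_⟩
      · have h1 := mul_mem_homPiece hα ha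
        have h2 := mul_mem_homPiece hβ hb
        rw [sub_add_cancel] at h1 h2
        exact add_mem h1 h2
      · exact add_mem (Ideal.mul_mem_left _ _ (Ideal.mem_sup_right
          (Ideal.mem_span_singleton_self a))) (Ideal.mul_mem_left _ _ (Ideal.mem_sup_left
          (Ideal.mem_sup_right (Ideal.mem_span_singleton_self b))))
  have s2 : (quotPiece Q (i - d)).prod (quotPiece Q (i - d)) ⊓ LinearMap.ker μ =
      (quotPiece Q (i - d - d)).map ν := by
    ext ⟨x, y⟩
    constructor
    · rintro ⟨⟨hx, hy⟩, hxy⟩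
      obtain ⟨α, hα, rfl⟩ := mem_quotPiece.1 hx
      obtain ⟨β, hβ, rfl⟩ := mem_quotPiece.1 hy
      have hxy : μ _ = 0 := hxy
      rw [hμ, Ideal.Quotient.eq_zero_iff_mem] at hxy
      obtain ⟨ρ, hρ, h0, h1⟩ := h.exists_quotient hg ha hb (by omega) hα hβ hxy
      refine ⟨Ideal.Quotient.mk Q ρ, mem_quotPiece.2 ⟨ρ, hρ, rfl⟩, ?_⟩
      rw [hν]
      refine Prod.ext (Ideal.Quotient.eq.2 h0).symm (Ideal.Quotient.eq.2 ?_).symm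
      rwa [sub_neg_eq_add]
    · rintro ⟨z, hz, hzxy⟩
      obtain ⟨γ, hγ, rfl⟩ := mem_quotPiece.1 hz
      rw [hν] at hzxy
      rw [← hzxy]
      refine ⟨⟨mem_quotPiece.2 ⟨_, ?_, rfl⟩, mem_quotPiece.2 ⟨_, neg_mem ?_, rfl⟩⟩, ?_⟩
      · have := mul_mem_homPiece hγ hb
        rwa [sub_add_cancel] at this
      · have := mul_mem_homPiece hγ ha
        rwa [sub_add_cancel] at this
      · change μ _ = 0
        rw [hμ, Ideal.Quotient.eq_zero_iff_mem]
        convert zero_mem Q using 1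
        ring
  have s3 : quotPiece Q (i - d - d) ⊓ LinearMap.ker ν = ⊥ := by
    rw [eq_bot_iff]
    rintro z ⟨hz, hz'⟩
    obtain ⟨γ, hγ, rfl⟩ := mem_quotPiece.1 hz
    have hz' : ν _ = 0 := hz'
    rw [hν] at hz'
    have h0 := congrArg Prod.snd hz'
    rw [Prod.snd_zero, Ideal.Quotient.eq_zero_iff_mem, neg_mem_iff] at h0
    exact Ideal.Quotient.eq_zero_iff_mem.2 (h.mem_of_mul_mem hd hg ha hb (by omega) hγ h0)
  rw [map_factor_quotPiece, s1] at e1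
  rw [s2, hprod.finrank_eq, Module.finrank_prod] at e2
  rw [s3, finrank_bot] at e3
  unfold hilb
  omega

/-- If the torsion of the first Koszul homology vanishes in low degrees, multiplication by `l`
is injective on `R ⧸ (g, a, b)` in a high degree. -/
theorem TorsionFreeUpTo.mem_of_mul_mem [Infinite K] (hg : ∀ t, g t ∈ homPiece K n d)
    (ha : a ∈ homPiece K n d) (hb : b ∈ homPiece K n d) (hexact : KoszulExact g) {σ : ℤ}
    (hgor : GorSocle 1 σ (Ideal.span (Set.range g))) {l : MvPolynomial (Fin n) K}
    (hl : l ∈ homPiece K n 1) (hlg : IsRegOn l (Ideal.span (Set.range g))) {t : ℕ}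
    (ht : idealOfVars (Fin n) K ^ t ≤ Ideal.span (Set.range g) ⊔ Ideal.span {l})
    (h : TorsionFreeUpTo (Fin.cons a (Fin.cons b g) : Fin (r + 2) → MvPolynomial (Fin n) K) M)
    {j : ℤ} (hj : σ - j + d - 1 ≤ M) {p : MvPolynomial (Fin n) K} (hp : p ∈ homPiece K n j)
    (hlp : l * p ∈ Ideal.span (Set.range g) ⊔ Ideal.span {b} ⊔ Ideal.span {a}) :
    p ∈ Ideal.span (Set.range g) ⊔ Ideal.span {b} ⊔ Ideal.span {a} := by
  set Q := Ideal.span (Set.range g) with hQdef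
  have hQ : IsHomog Q := isHomog_span_range hg
  set J := Q ⊔ Ideal.span {b} ⊔ Ideal.span {a} with hJdef
  have hJ : IsHomog J := (hQ.sup_span hb).sup_span ha
  by_contra hpJ
  -- Since N > j, no nonzero multiple of l^N has degree j, so p stays outside J + (l^N).
  obtain ⟨N, hN0, hNj⟩ : ∃ N : ℕ, 0 < N ∧ j < N := ⟨j.toNat + 1, by omega, by omega⟩
  have hlN := pow_mem_homPiece hl N
  rw [mul_one] at hlN
  have hlNreg := hlg.pow N
  set L := l ^ N with hL
  have hline : SocleLine (σ + (N - 1)) (Q ⊔ Ideal.span {L}) :=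
    hgor.exchange hQ (by exact_mod_cast hN0) hlN hlNreg
  obtain ⟨N', hN'⟩ := exists_pow_le_sup_span_pow ht N
  have hQL := hQ.sup_span hlN
  have hJL : Q ⊔ Ideal.span {L} ≤ J ⊔ Ideal.span {L} :=
    sup_le_sup_right (le_sup_left.trans le_sup_left) _
  have hpJL : p ∉ J ⊔ Ideal.span {L} := by
    intro hmem
    obtain ⟨s, hs, hps⟩ := hJ.exists_of_mem_sup_span hlN hp hmem
    rw [homPiece_of_neg (by omega), Submodule.mem_bot] at hs
    rw [hs, mul_zero, sub_zero] at hps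
    exact hpJ hps
  obtain ⟨y, hy, hyp, hyJ⟩ := hline.exists_separating hQL hN' hJL hp hpJL
  have hya := hyJ _ a ha (Ideal.mem_sup_left (Ideal.mem_sup_right
    (Ideal.mem_span_singleton_self a)))
  have hyb := hyJ _ b hb (Ideal.mem_sup_left (Ideal.mem_sup_left (Ideal.mem_sup_right
    (Ideal.mem_span_singleton_self b))))
  obtain ⟨α, hα, hyα⟩ := hQ.exists_of_mem_sup_span hlN (mul_mem_homPiece hy ha) hya
  obtain ⟨β, hβ, hyβ⟩ := hQ.exists_of_mem_sup_span hlN (mul_mem_homPiece hy hb) hyb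
  -- From ya = Lα and yb = Lβ modulo Q, cancelling L gives a cycle. Its coefficients have degree σ -
  -- j + d - 1, independent of N.
  have hcycle : β * a + -α * b ∈ Q := by
    refine hlNreg _ ?_
    have := sub_mem (Q.mul_mem_left b hyα) (Q.mul_mem_left a hyβ)
    convert this using 1
    ring
  obtain ⟨u, hu0, hu1, hu, hsyz⟩ :=
    exists_homogeneous_syzygy hg ha hb hβ (neg_mem hα) hcycle
  -- A high power of 𝔪 lies in Q + (L). If q = Lq' modulo Q, then q(β, -α) = q'y(b, -a) there, which
  -- is Koszul; so the class of u is torsion.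
  have hukos := h _ (by omega) u hu hsyz ⟨N', fun q hq => by
    obtain ⟨q', hq'⟩ := mem_sup_span_singleton.1 (hN' hq)
    refine cons_cons_mem_koszul hexact (ρ := q' * y) ?_ ?_ ?_
    · rw [smul_dotProduct, hsyz, smul_zero]
    · rw [Pi.smul_apply, hu0, smul_eq_mul]
      have := sub_mem (Q.mul_mem_left β hq') (Q.mul_mem_left q' hyβ)
      convert this using 1
      ring
    · rw [Pi.smul_apply, hu1, smul_eq_mul]
      have := sub_mem (Q.mul_mem_left q' hyα) (Q.mul_mem_left α hq')
      convert this using 1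
      ring⟩
  obtain ⟨ρ, h0, h1⟩ := exists_of_cons_cons_mem_koszul hukos
  rw [hu0] at h0
  rw [hu1] at h1
  obtain ⟨s, hs⟩ := mem_sup_span_singleton.1 hlp
  obtain ⟨s', hs'⟩ := mem_sup_span_singleton.1 hs
  -- As β = ρb and α = ρa modulo Q, the element y - Lρ kills a and b, hence lp, hence p by
  -- regularity of l. This puts yp in Q + (L), a contradiction.
  have hkb : (y - L * ρ) * b ∈ Q := by
    have := add_mem hyβ (Q.mul_mem_left L h0)
    convert this using 1
    ring
  have hka : (y - L * ρ) * a ∈ Q := by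
    have := sub_mem hyα (Q.mul_mem_left L h1)
    convert this using 1
    ring
  have hkp : (y - L * ρ) * p ∈ Q := by
    refine hlg _ ?_
    have := add_mem (add_mem (Q.mul_mem_left (y - L * ρ) hs') (Q.mul_mem_left s hka))
      (Q.mul_mem_left s' hkb)
    convert this using 1
    ring
  refine hyp (mem_sup_span_singleton.2 ⟨ρ * p, ?_⟩)
  convert hkp using 1
  ring

end Threshold

/-! ### The contradiction over an infinite field -/

section Core

open Matrix

variable {K : Type*} [Field K] {n : ℕ}

theorem GorSocle.ne_top {r : ℕ} {σ : ℤ} {Q : Ideal (MvPolynomial (Fin n) K)}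
    (h : GorSocle r σ Q) : Q ≠ ⊤ := by
  induction r generalizing Q with
  | zero =>
    obtain ⟨s, -, hs, -⟩ := h
    rintro rfl
    exact hs trivial
  | succ r ih =>
    obtain ⟨z, -, -, h⟩ := h
    rintro rfl
    exact ih h (top_sup_eq _)

/-- General linear combinations of forms generating an ideal of dimension at most one form a
regular sequence of length `n - 1`. -/
theorem exists_regular_combinations [Infinite K] {ι : Type*} [Fintype ι] {m d : ℕ} (hd : 0 < d)
    {F : ι → MvPolynomial (Fin (m + 1)) K} (hF : ∀ i, F i ∈ homPiece K (m + 1) d)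
    (hdim : DimLEOne (Ideal.span (Set.range F))) {r : ℕ} (hr : r ≤ m) :
    ∃ c : Fin r → ι → K, LinearIndependent K c ∧
      KoszulExact (Fintype.linearCombination K F ∘ c) ∧
      GorSocle (m + 1 - r) (r * ((d : ℤ) - 1))
        (Ideal.span (Set.range (Fintype.linearCombination K F ∘ c))) ∧
      hilb (Ideal.span (Set.range (Fintype.linearCombination K F ∘ c))) =
        ((1 - shift ^ d) ^ r) (hilb (⊥ : Ideal (MvPolynomial (Fin (m + 1)) K))) := by
  induction r with
  | zero =>
    refine ⟨Fin.elim0, linearIndependent_empty_type, fun u _ => ?_, ?_, ?_⟩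
    · rw [Subsingleton.elim u 0]
      exact zero_mem _
    · simpa using gorSocle_bot (K := K) (n := m + 1)
    · simp
  | succ r ih =>
    obtain ⟨c, hc, hexact, hgor, hhilb⟩ := ih (by omega)
    have hV : ∀ v, Fintype.linearCombination K F v ∈ homPiece K (m + 1) d := fun v => by
      rw [Fintype.linearCombination_apply]
      exact sum_mem fun i _ => Submodule.smul_mem _ _ (hF i)
    set g := Fintype.linearCombination K F ∘ c with hg
    have hQ : IsHomog (Ideal.span (Set.range g)) := isHomog_span_range fun t => hV (c t)
    -- Depth at least two remains before each choice, as `GorSocle.mem_of_mul_mem` requires; this is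
    -- why the sequence stops at length m.
    obtain ⟨k, hk⟩ : ∃ k, m + 1 - r = k + 2 := ⟨m - 1 - r, by omega⟩
    rw [hk] at hgor
    obtain ⟨_, ⟨v, rfl⟩, hv⟩ := exists_mem_forall_isRegOn
      (LinearMap.range (Fintype.linearCombination K F)) (Set.finite_singleton _) (by
        rintro Q rfl x hx
        classical
        exact hgor.mem_of_mul_mem hQ hF hdim fun i => by
          simpa using hx _ ⟨Pi.single i 1, rfl⟩)
    have hv := hv _ rfl
    have hcons : Fintype.linearCombination K F ∘ (Fin.cons v c : Fin (r + 1) → ι → K) =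
        (Fin.cons (Fintype.linearCombination K F v) g : Fin (r + 1) → _) := by
      ext i
      refine Fin.cases ?_ (fun i => ?_) i <;> simp [hg]
    refine ⟨Fin.cons v c, linearIndependent_finCons.2 ⟨hc, fun hspan => ?_⟩, ?_, ?_, ?_⟩
    -- If `v` were in the span of `c`, its form would lie in the ideal of g, and its regularity
    -- there would put 1 in that ideal.
    · refine hgor.ne_top ((Ideal.eq_top_iff_one _).2 (hv 1 ?_))
      rw [mul_one]
      have h1 := Submodule.mem_map_of_mem (f := Fintype.linearCombination K F) hspan
      rw [Submodule.map_span, ← Set.range_comp] at h1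
      have h2 : Submodule.span K (Set.range g) ≤
          (Ideal.span (Set.range g)).restrictScalars K :=
        Submodule.span_le.2 Ideal.subset_span
      exact h2 h1
    · rw [hcons]
      exact hexact.cons hv
    · rw [hcons, span_range_finCons]
      have := hgor.exchange hQ (by exact_mod_cast hd) (hV v) hv
      convert this using 1
      · omega
      · push_cast
        ring
    · rw [hcons, span_range_finCons, hilb_sup_span_eq hQ (hV v) hv, hhilb, pow_succ',
        Module.End.mul_apply]

theorem vecMul_mem_homPiece {ι κ : Type*} [Fintype κ] (P : Matrix κ ι K) {c : ℤ}
    {u : κ → MvPolynomial (Fin n) K} (hu : ∀ i, u i ∈ homPiece K n c) (i : ι) :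
    (u ᵥ* P.map C) i ∈ homPiece K n c := by
  refine sum_mem fun j _ => ?_
  change u j * C (P j i) ∈ _
  rw [mul_comm, ← smul_eq_C_mul]
  exact Submodule.smul_mem _ _ (hu j)

section BasisChange

variable {ι : Type*} [Fintype ι] [DecidableEq ι] {F : ι → MvPolynomial (Fin n) K} {M : ℤ}
  {P : Matrix ι ι K}

theorem map_C_mul_map_C_inv (hP : IsUnit P) :
    P.map (C : K → MvPolynomial (Fin n) K) * P⁻¹.map C = 1 := by
  rw [← Matrix.map_mul, Matrix.mul_nonsing_inv _ ((Matrix.isUnit_iff_isUnit_det P).1 hP)]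
  exact Matrix.map_one _ C_0 C_1

theorem map_C_inv_mul_map_C (hP : IsUnit P) :
    P⁻¹.map (C : K → MvPolynomial (Fin n) K) * P.map C = 1 := by
  rw [← Matrix.map_mul, Matrix.nonsing_inv_mul _ ((Matrix.isUnit_iff_isUnit_det P).1 hP)]
  exact Matrix.map_one _ C_0 C_1

theorem vecMul_mem_koszul_iff (hP : IsUnit P) {u : ι → MvPolynomial (Fin n) K} :
    u ᵥ* P.map C ∈ koszul F ↔ u ∈ koszul (P.map C *ᵥ F) := by
  refine ⟨fun h => ?_, vecMul_mem_koszul _⟩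
  have h1 : F = P⁻¹.map C *ᵥ (P.map C *ᵥ F) := by
    rw [Matrix.mulVec_mulVec, map_C_inv_mul_map_C hP, Matrix.one_mulVec]
  rw [h1] at h
  have := vecMul_mem_koszul _ h
  rwa [Matrix.vecMul_vecMul, map_C_mul_map_C_inv hP, Matrix.vecMul_one] at this

theorem KoszulUpTo.basis_change (h : KoszulUpTo F M) (hP : IsUnit P) :
    KoszulUpTo (P.map C *ᵥ F) M := fun c hc u hu hsyz =>
  (vecMul_mem_koszul_iff hP).1 (h c hc _ (vecMul_mem_homPiece P hu)
    (by rwa [← Matrix.dotProduct_mulVec]))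

theorem TorsionFreeUpTo.basis_change (h : TorsionFreeUpTo F M) (hP : IsUnit P) :
    TorsionFreeUpTo (P.map C *ᵥ F) M := fun c hc u hu hsyz ⟨N, hN⟩ =>
  (vecMul_mem_koszul_iff hP).1 (h c hc _ (vecMul_mem_homPiece P hu)
    (by rwa [← Matrix.dotProduct_mulVec]) ⟨N, fun q hq => by
      rw [← Matrix.smul_vecMul]
      exact (vecMul_mem_koszul_iff hP).2 (hN q hq)⟩)

end BasisChange

/-- Over an infinite field, the first Koszul homology of `n + 1` forms in `n` variables, generating
an ideal of dimension at most one, has a nonzero class or a nonzero torsion class in low degree. -/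
theorem not_koszulUpTo_and_torsionFreeUpTo [Infinite K] {m d M : ℕ} (hm : 2 ≤ m) (hd : 2 ≤ d)
    (hM : 2 * (M : ℤ) ≤ (m - 1) * (d - 1)) (hM' : ((m : ℤ) - 1) * (d - 1) ≤ 2 * M + 1)
    {F : Fin (m + 2) → MvPolynomial (Fin (m + 1)) K} (hF : ∀ i, F i ∈ homPiece K (m + 1) d)
    (hdim : DimLEOne (Ideal.span (Set.range F))) (h : KoszulUpTo F M)
    (h' : TorsionFreeUpTo F (M + d)) : False := by
  obtain ⟨c, hc, hexact, hgor, hhilb⟩ :=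
    exists_regular_combinations (by omega : 0 < d) hF hdim le_rfl
  obtain ⟨vb, hvb⟩ := exists_linearIndependent_cons_of_lt_finrank hc (by simp)
  obtain ⟨va, hva⟩ := exists_linearIndependent_cons_of_lt_finrank hvb (by simp)
  have hV : ∀ v, Fintype.linearCombination K F v ∈ homPiece K (m + 1) d := fun v => by
    rw [Fintype.linearCombination_apply]
    exact sum_mem fun i _ => Submodule.smul_mem _ _ (hF i)
  set g := Fintype.linearCombination K F ∘ c with hg
  set a := Fintype.linearCombination K F va
  set b := Fintype.linearCombination K F vb
  let P : Matrix (Fin (m + 2)) (Fin (m + 2)) K := Matrix.of (Fin.cons va (Fin.cons vb c))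
  have hP : IsUnit P := Matrix.linearIndependent_rows_iff_isUnit.1 hva
  have hPF : P.map C *ᵥ F = (Fin.cons a (Fin.cons b g) : Fin (m + 2) → _) := by
    ext1 i
    have : (P.map C *ᵥ F) i = Fintype.linearCombination K F (P i) := by
      simp [Matrix.mulVec, dotProduct, Fintype.linearCombination_apply, smul_eq_C_mul]
    rw [this]
    refine Fin.cases rfl (fun i => Fin.cases rfl (fun i => rfl) i) i
  have hA := h.basis_change hP
  have hB := h'.basis_change hP
  rw [hPF] at hA hB
  set Q := Ideal.span (Set.range g) with hQdef
  have hQ : IsHomog Q := isHomog_span_range fun t => hV (c t)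
  rw [show m + 1 - m = 1 by omega] at hgor
  obtain ⟨l, hl, hlQ, -⟩ := id hgor
  have hl1 : hilb (Q ⊔ Ideal.span {l}) = gaussCoeff d m := by
    have := hilb_sup_span_eq hQ (e := 1) (by simpa using hl) hlQ
    rw [this, hhilb, pow_one, ← Module.End.mul_apply, one_sub_shift_mul_pow,
      Module.End.mul_apply, pow_one_sub_shift_hilb_bot]
    rfl
  have hdiff : ∀ i, hilb Q i - hilb Q (i - 1) = gaussCoeff d m i := fun i => by
    rw [← hl1, hilb_sup_span hQ hl hlQ]
  have hpow : idealOfVars (Fin (m + 1)) K ^ (m * (d - 1) + 1) ≤ Q ⊔ Ideal.span {l} := by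
    refine pow_idealOfVars_le_of_homPiece_le fun i hi p hp => homPiece_le_of_hilb_eq_zero ?_ hp
    rw [hl1]
    refine gaussCoeff_of_gt ?_
    push_cast [Nat.cast_sub (show 1 ≤ d by omega)] at hi
    omega
  have hmd : (m : ℤ) * (d - 1) = (m - 1) * (d - 1) + (d - 1) := by ring
  have hgd : ∀ t, g t ∈ homPiece K (m + 1) d := fun t => hV (c t)
  -- With σ = m(d-1) and j = M + d - 1, the degree condition is m(d-1) - M ≤ M + d, which is `hM'`.
  have hle := hilb_le_of_linear (i := M + d - 1) hl fun p hp hlp =>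
    hB.mem_of_mul_mem hgd (hV va) (hV vb) hexact hgor hl hlQ hpow (by omega) hp hlp
  have hd0 : (0 : ℤ) < d := by omega
  rw [hA.hilb_eq hd0 hgd (hV va) (hV vb) (by omega),
    hA.hilb_eq hd0 hgd (hV va) (hV vb) (by omega)] at hle
  rw [← hQdef] at hle
  -- By `hle`, G(M+d) - 2G(M) + G(M-d) ≥ 0 for G = `gaussCoeff d m`; the three inequalities `g1`,
  -- `g2`, `g3` make it negative.
  have d1 := hdiff (M + d)
  have d2 := hdiff M
  have d3 := hdiff (M - d)
  have g1 : gaussCoeff d m (M + d) ≤ gaussCoeff d m M := by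
    rw [← gaussCoeff_symm]
    exact gaussCoeff_le (by omega) (by omega)
  have g2 : gaussCoeff d m (M - d) ≤ gaussCoeff d m (M - 1) :=
    gaussCoeff_le (by omega) (by omega)
  have g3 : gaussCoeff d m (M - 1) < gaussCoeff d m M :=
    gaussCoeff_pred_lt (by omega) hm (by omega) (by omega)
  rw [show (M + d - 1 + 1 : ℤ) = M + d by ring, show (M + d - 1 - d : ℤ) = M - 1 by ring,
    show (M + d - d : ℤ) = M by ring, show (M - 1 - d : ℤ) = M - d - 1 by ring] at hle
  omega

end Core

/-! ### Base change to a larger field -/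

section BaseChange

open Matrix

variable {k : Type*} [Field k] {K : Type*} [Field K] [Algebra k K] {n : ℕ}

/-- A linear functional on `K` applied to the coefficients of a polynomial. -/
def coeffwise (φ : K →ₗ[k] k) (p : MvPolynomial (Fin n) K) : MvPolynomial (Fin n) k :=
  ∑ x ∈ p.support, monomial x (φ (coeff x p))

theorem coeff_coeffwise (φ : K →ₗ[k] k) (p : MvPolynomial (Fin n) K) (x : Fin n →₀ ℕ) :
    coeff x (coeffwise φ p) = φ (coeff x p) := by
  classical
  rw [coeffwise, coeff_sum]
  simp only [coeff_monomial, Finset.sum_ite_eq']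
  split_ifs with h
  · rfl
  · rw [notMem_support_iff.1 h, map_zero]

theorem coeffwise_sub (φ : K →ₗ[k] k) (p q : MvPolynomial (Fin n) K) :
    coeffwise φ (p - q) = coeffwise φ p - coeffwise φ q := by
  ext x
  simp [coeff_coeffwise]

theorem coeffwise_zero (φ : K →ₗ[k] k) : coeffwise φ (0 : MvPolynomial (Fin n) K) = 0 := by
  ext x
  simp [coeff_coeffwise]

theorem coeffwise_sum (φ : K →ₗ[k] k) {ι : Type*} (s : Finset ι)
    (p : ι → MvPolynomial (Fin n) K) :
    coeffwise φ (∑ i ∈ s, p i) = ∑ i ∈ s, coeffwise φ (p i) := by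
  ext x
  simp [coeff_coeffwise, coeff_sum]

theorem coeffwise_mul_map (φ : K →ₗ[k] k) (p : MvPolynomial (Fin n) K)
    (q : MvPolynomial (Fin n) k) :
    coeffwise φ (p * map (algebraMap k K) q) = coeffwise φ p * q := by
  classical
  ext x
  rw [coeff_coeffwise, coeff_mul, coeff_mul, map_sum]
  refine Finset.sum_congr rfl fun y _ => ?_
  rw [coeff_coeffwise, coeff_map, mul_comm, ← Algebra.smul_def, map_smul, smul_eq_mul, mul_comm]

theorem coeffwise_mem (φ : K →ₗ[k] k) {c : ℤ} {p : MvPolynomial (Fin n) K}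
    (hp : p ∈ homPiece K n c) : coeffwise φ p ∈ homPiece k n c := by
  rcases homPiece_cases hp with rfl | ⟨c, rfl, hc⟩
  · rw [coeffwise_zero]
    exact zero_mem _
  · rw [mem_homPiece_natCast]
    intro x hx
    rw [coeff_coeffwise] at hx
    exact hc fun h => hx (by rw [h, map_zero])

/-- Polynomials over `K` are combinations of polynomials over `k` along a basis of `K`. -/
theorem exists_eq_sum_coeffwise {κ ι : Type*} [Finite ι] (B : Module.Basis κ k K)
    (u : ι → MvPolynomial (Fin n) K) : ∃ T : Finset κ, ∀ i,
      u i = ∑ t ∈ T, C (B t) * map (algebraMap k K) (coeffwise (B.coord t) (u i)) := by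
  classical
  cases nonempty_fintype ι
  refine ⟨Finset.univ.biUnion fun i => (u i).support.biUnion fun x =>
    (B.repr (coeff x (u i))).support, fun i => ?_⟩
  ext x
  rw [coeff_sum]
  simp only [coeff_C_mul, coeff_map, coeff_coeffwise, Module.Basis.coord_apply]
  by_cases hx : x ∈ (u i).support
  · conv_lhs => rw [← B.linearCombination_repr (coeff x (u i))]
    rw [Finsupp.linearCombination_apply, Finsupp.sum_of_support_subset (s := Finset.univ.biUnion
      fun i => (u i).support.biUnion fun x => (B.repr (coeff x (u i))).support)]
    · exact Finset.sum_congr rfl fun t _ => by rw [Algebra.smul_def, mul_comm]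
    · intro t ht
      exact Finset.mem_biUnion.2 ⟨i, Finset.mem_univ _, Finset.mem_biUnion.2 ⟨x, hx, ht⟩⟩
    · simp
  · simp [notMem_support_iff.1 hx]

variable {ι : Type*} [Fintype ι] {f : ι → MvPolynomial (Fin n) k} {M : ℤ}

theorem map_mem_koszul {u : ι → MvPolynomial (Fin n) k} (h : u ∈ koszul f) :
    (fun i => map (algebraMap k K) (u i)) ∈ koszul (fun i => map (algebraMap k K) (f i)) := by
  obtain ⟨b, rfl⟩ := mem_koszul.1 h
  refine mem_koszul.2 ⟨b.map (map (algebraMap k K)), ?_⟩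
  ext1 i
  simp [Matrix.mulVec, dotProduct]

theorem coeffwise_mem_koszul (φ : K →ₗ[k] k) {u : ι → MvPolynomial (Fin n) K}
    (h : u ∈ koszul (fun i => map (algebraMap k K) (f i))) :
    (fun i => coeffwise φ (u i)) ∈ koszul f := by
  obtain ⟨b, rfl⟩ := mem_koszul.1 h
  refine mem_koszul.2 ⟨b.map (coeffwise φ), ?_⟩
  ext1 i
  simp [Matrix.mulVec, dotProduct, coeffwise_sum, coeffwise_mul_map, coeffwise_sub]

theorem coeffwise_dotProduct (φ : K →ₗ[k] k) {u : ι → MvPolynomial (Fin n) K}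
    (h : u ⬝ᵥ (fun i => map (algebraMap k K) (f i)) = 0) :
    (fun i => coeffwise φ (u i)) ⬝ᵥ f = 0 := by
  have := congrArg (coeffwise φ) h
  simpa [dotProduct, coeffwise_sum, coeffwise_mul_map, coeffwise_zero] using this

/-- Expand u along a basis of K over k. Its coordinate vectors are Koszul over k by hypothesis, and
u is a K-combination of them. -/
theorem mem_koszul_of_forall_coeffwise {u : ι → MvPolynomial (Fin n) K}
    (h : ∀ φ : K →ₗ[k] k, (fun i => coeffwise φ (u i)) ∈ koszul f) :
    u ∈ koszul (fun i => map (algebraMap k K) (f i)) := by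
  obtain ⟨T, hT⟩ := exists_eq_sum_coeffwise (Module.Basis.ofVectorSpace k K) u
  have : u = ∑ t ∈ T, (C (Module.Basis.ofVectorSpace k K t) : MvPolynomial (Fin n) K) • fun i =>
      map (algebraMap k K) (coeffwise ((Module.Basis.ofVectorSpace k K).coord t) (u i)) := by
    ext1 i
    rw [hT i, Finset.sum_apply]
    refine Finset.sum_congr rfl fun t _ => ?_
    rfl
  rw [this]
  exact sum_mem fun t _ => Submodule.smul_mem _ _ (map_mem_koszul (h _))

variable (K) in
theorem KoszulUpTo.map (h : KoszulUpTo f M) :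
    KoszulUpTo (fun i => map (algebraMap k K) (f i)) M := fun c hc _ hu hsyz =>
  mem_koszul_of_forall_coeffwise fun φ => h c hc _ (fun i => coeffwise_mem φ (hu i))
    (coeffwise_dotProduct φ hsyz)

theorem map_mem_pow_idealOfVars {N : ℕ} {q : MvPolynomial (Fin n) k}
    (hq : q ∈ idealOfVars (Fin n) k ^ N) :
    MvPolynomial.map (algebraMap k K) q ∈ idealOfVars (Fin n) K ^ N := by
  rw [mem_pow_idealOfVars_iff'] at hq ⊢
  intro x hx
  rw [coeff_map, hq x hx, map_zero]

variable (K) in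
theorem TorsionFreeUpTo.map (h : TorsionFreeUpTo f M) :
    TorsionFreeUpTo (fun i => map (algebraMap k K) (f i)) M := fun c hc u hu hsyz ⟨N, hN⟩ =>
  mem_koszul_of_forall_coeffwise fun φ => h c hc _ (fun i => coeffwise_mem φ (hu i))
    (coeffwise_dotProduct φ hsyz) ⟨N, fun q hq => by
      convert coeffwise_mem_koszul φ (hN _ (map_mem_pow_idealOfVars hq)) using 1
      ext1 i
      rw [Pi.smul_apply, Pi.smul_apply, smul_eq_mul, smul_eq_mul, mul_comm,
        mul_comm (MvPolynomial.map _ _), coeffwise_mul_map]⟩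

-- The polynomial ring over K is integral over the one over k. Strict inclusions of primes therefore
-- contract to strict inclusions, and a prime with maximal contraction is maximal.
attribute [local instance] MvPolynomial.algebraMvPolynomial in
variable (K) in
theorem DimLEOne.map {κ : Type*} {f : κ → MvPolynomial (Fin n) k} [Algebra.IsIntegral k K]
    (h : DimLEOne (Ideal.span (Set.range f))) :
    DimLEOne (Ideal.span (Set.range fun i => MvPolynomial.map (algebraMap k K) (f i))) := by
  intro P P' hP hP' hIP hlt
  obtain ⟨hle, x, hxP', hxP⟩ := SetLike.lt_iff_le_and_exists.1 hlt
  refine Ideal.isMaximal_of_isIntegral_of_isMaximal_comap (R := MvPolynomial (Fin n) k) P'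
    (h (P.comap (algebraMap _ _)) _ (hP.comap _) (hP'.comap _) ?_
      (Ideal.comap_lt_comap_of_integral_mem_sdiff hle ⟨hxP', hxP⟩
        (Algebra.IsIntegral.isIntegral x)))
  rw [Ideal.span_le]
  rintro _ ⟨i, rfl⟩
  exact hIP (Ideal.subset_span ⟨i, rfl⟩)

theorem dimLEOne_of_ringKrullDim_le {A : Type*} [CommRing A] {I : Ideal A}
    (h : ringKrullDim (A ⧸ I) ≤ 1) : DimLEOne I := by
  intro P P' hP hP' hIP hlt
  rw [ringKrullDim_quotient, Order.krullDim_le_one_iff] at h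
  rcases h ⟨⟨P', hP'⟩, hIP.trans hlt.le⟩ with hmin | hmax
  · exact absurd (hmin (b := ⟨⟨P, hP⟩, hIP⟩) hlt.le) (not_le_of_gt hlt)
  · obtain ⟨J, hJ, hle⟩ := Ideal.exists_le_maximal P' hP'.ne_top
    have : J ≤ P' := hmax (b := ⟨⟨J, hJ.isPrime⟩, (hIP.trans hlt.le).trans hle⟩) hle
    rwa [le_antisymm hle this]

end BaseChange

/-! ### From graded pieces of Koszul homology to conditions on syzygies -/

section Translation

open Matrix

variable {k : Type*} [Field k] {n m : ℕ} {f : Fin m → MvPolynomial (Fin n) k}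

/-- In the matrix form the pairs (i, j) need no ordering: reversed pairs give negatives and diagonal
ones zero, so the relations with i < j already generate. -/
theorem koszul_eq_B₁ {A : Type*} [CommRing A] (F : Fin m → A) : koszul F = B₁ F := by
  have hpair : ∀ i j, F i • Pi.single j (1 : A) - F j • Pi.single i (1 : A) ∈ B₁ F := by
    have hlt : ∀ i j, i < j → F i • Pi.single j (1 : A) - F j • Pi.single i (1 : A) ∈ B₁ F :=
      fun i j hij => ⟨Pi.single ⟨(i, j), hij⟩ 1, by
        rw [d₂, Fintype.linearCombination_apply_single, one_smul]⟩
    intro i j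
    rcases lt_trichotomy i j with hij | rfl | hij
    · exact hlt i j hij
    · rw [sub_self]
      exact zero_mem _
    · rw [← neg_sub]
      exact neg_mem (hlt j i hij)
  apply le_antisymm
  · intro u hu
    obtain ⟨b, rfl⟩ := mem_koszul.1 hu
    have : (b - bᵀ) *ᵥ F =
        ∑ i, ∑ j, b i j • (F j • Pi.single i (1 : A) - F i • Pi.single j (1 : A)) := by
      ext1 t
      simp only [smul_sub, Finset.sum_sub_distrib, Pi.sub_apply, Finset.sum_apply, Pi.smul_apply,
        smul_eq_mul, Pi.single_apply, mul_ite, mul_one, mul_zero, Finset.sum_ite_eq,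
        Finset.mem_univ, if_true, Matrix.sub_mulVec]
      rw [Finset.sum_comm]
      simp [Matrix.mulVec, dotProduct]
    rw [this]
    exact sum_mem fun i _ => sum_mem fun j _ => Submodule.smul_mem _ _ (hpair j i)
  · rintro _ ⟨c, rfl⟩
    rw [d₂, Fintype.linearCombination_apply]
    refine sum_mem fun p _ => Submodule.smul_mem _ _
      (mem_koszul.2 ⟨Matrix.single p.1.2 p.1.1 1, ?_⟩)
    rw [Matrix.sub_mulVec, Matrix.transpose_single]
    ext1 t
    simp [Matrix.single_mulVec, Pi.single_apply, Function.update_apply]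

theorem mem_Z₁_iff {u : Fin m → MvPolynomial (Fin n) k} : u ∈ Z₁ f ↔ u ⬝ᵥ f = 0 := by
  rw [LinearMap.mem_ker, d₁, Fintype.linearCombination_apply]
  rfl

theorem mem_Z₁piece {d c : ℕ} {u : Z₁ f} (hu : ∀ i, u.1 i ∈ homPiece k n (c : ℤ)) :
    u ∈ Z₁piece f d (c + d) := by
  refine fun i _ => ?_
  rw [shiftedPiece, if_pos (by omega), Nat.add_sub_cancel]
  exact mem_homPiece_natCast.1 (hu i)

theorem mk_eq_zero_iff_mem_koszul {u : Z₁ f} :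
    ((B₁ f).submoduleOf (Z₁ f)).mkQ u = 0 ↔ u.1 ∈ koszul f := by
  rw [Submodule.mkQ_apply, Submodule.Quotient.mk_eq_zero, koszul_eq_B₁]
  rfl

theorem koszulUpTo_of_H₁piece {d : ℕ} {M : ℤ}
    (h : ∀ μ : ℕ, (μ : ℤ) ≤ M + d → H₁piece f d μ = ⊥) : KoszulUpTo f M := by
  intro c hc u hu hsyz
  rcases lt_or_ge c 0 with hc0 | hc0
  · rw [show u = 0 from funext fun i => by simpa [homPiece_of_neg hc0] using hu i]
    exact zero_mem _
  obtain ⟨c, rfl⟩ := Int.eq_ofNat_of_zero_le hc0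
  have h1 := h (c + d) (by push_cast; omega)
  have h2 : ((B₁ f).submoduleOf (Z₁ f)).mkQ ⟨u, mem_Z₁_iff.2 hsyz⟩ ∈ H₁piece f d (c + d) :=
    ⟨_, mem_Z₁piece (by simpa using hu), rfl⟩
  rw [h1, Submodule.mem_bot, mk_eq_zero_iff_mem_koszul] at h2
  exact h2

theorem torsionFreeUpTo_of_H0H₁piece {d : ℕ} {M : ℤ}
    (h : ∀ μ : ℕ, (μ : ℤ) ≤ M + d → H0H₁piece f d μ = ⊥) : TorsionFreeUpTo f M := by
  intro c hc u hu hsyz ⟨N, hN⟩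
  rcases lt_or_ge c 0 with hc0 | hc0
  · rw [show u = 0 from funext fun i => by simpa [homPiece_of_neg hc0] using hu i]
    exact zero_mem _
  obtain ⟨c, rfl⟩ := Int.eq_ofNat_of_zero_le hc0
  have h1 := h (c + d) (by push_cast; omega)
  have h2 : ((B₁ f).submoduleOf (Z₁ f)).mkQ ⟨u, mem_Z₁_iff.2 hsyz⟩ ∈ H0H₁piece f d (c + d) := by
    refine ⟨⟨N, fun q hq => ?_⟩, _, mem_Z₁piece (by simpa using hu), rfl⟩
    rw [← map_smul, mk_eq_zero_iff_mem_koszul]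
    exact hN q hq
  rw [h1, Submodule.mem_bot, mk_eq_zero_iff_mem_koszul] at h2
  exact h2

theorem eq_bot_of_lt_indeg {V : Type*} [AddCommGroup V] [Module k V] {P : ℕ → Submodule k V}
    {μ : ℕ} (h : (μ : ℕ∞) < indeg P) : P μ = ⊥ := by
  by_contra hne
  exact absurd (iInf₂_le (f := fun (μ : ℕ) (_ : P μ ≠ ⊥) => (μ : ℕ∞)) μ hne) (not_le_of_gt h)

theorem le_thresholdDegree_of_minIndeg_le {d : ℕ} {e B : ℤ} (h : minIndeg f d ≤ B)
    (he : e ≤ ((n : ℤ) - 1) * ((d : ℤ) - 1) - B) : (e : WithBot ℤ) ≤ thresholdDegree f d := by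
  unfold thresholdDegree
  generalize minIndeg f d = x at h
  -- An integer upper bound rules out the value `⊤`, so the threshold degree is not `⊥`: finiteness
  -- is part of the inequality.
  match x, h with
  | (a : ℤ), h =>
    have : a ≤ B := WithTop.coe_le_coe.1 h
    exact WithBot.coe_le_coe.2 (by omega)

end Translation

end KoszulThreshold

end

/-! ### The main theorem -/

theorem mainTheorem9 {k : Type*} [Field k] (n d : ℕ) (hn : 3 ≤ n) (hd : 2 ≤ d)
    (f : Fin (n + 1) → MvPolynomial (Fin n) k)
    (hf : ∀ i, (f i).IsHomogeneous d) (hli : LinearIndependent k f)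
    (I : Ideal (MvPolynomial (Fin n) k)) (hI : I = Ideal.span (Set.range f))
    (hdim : ringKrullDim (MvPolynomial (Fin n) k ⧸ I) ≤ 1)
    (hν : ∀ (p : Ideal (MvPolynomial (Fin n) k)) [p.IsPrime], I ≤ p →
      ((I.map (algebraMap (MvPolynomial (Fin n) k) (Localization.AtPrime p))).spanFinrank :
        WithBot ℕ∞) ≤ ringKrullDim (Localization.AtPrime p) + 1) :
    ((⌊(((n : ℚ) - 2) * ((d : ℚ) - 1) - 1) / 2⌋ : ℤ) : WithBot ℤ) ≤
      KoszulThreshold.thresholdDegree f d := by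
  subst hI
  obtain ⟨m, rfl⟩ : ∃ m, n = m + 1 := ⟨n - 1, by omega⟩
  set M : ℕ := (m - 1) * (d - 1) / 2 with hM
  have hcast : (((m - 1) * (d - 1) : ℕ) : ℤ) = ((m : ℤ) - 1) * ((d : ℤ) - 1) := by
    push_cast [Nat.cast_sub (show 1 ≤ d by omega), Nat.cast_sub (show 1 ≤ m by omega)]
    ring
  have hmd : (m : ℤ) * (d - 1) = (m - 1) * (d - 1) + (d - 1) := by ring
  -- With X = (m-1)(d-1), the right side is X - M - 1, and 2M ≤ X gives (X-1)/2 < X - M.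
  have hfloor : ⌊((((m + 1 : ℕ) : ℚ) - 2) * ((d : ℚ) - 1) - 1) / 2⌋ ≤
      (((m + 1 : ℕ) : ℤ) - 1) * ((d : ℤ) - 1) - (M + d) := by
    rw [← Int.lt_add_one_iff, Int.floor_lt]
    have h2 : 2 * (M : ℤ) ≤ (m - 1) * (d - 1) := by omega
    have h3 : 2 * (M : ℚ) ≤ (m - 1) * (d - 1) := by exact_mod_cast h2
    push_cast
    linarith
  refine KoszulThreshold.le_thresholdDegree_of_minIndeg_le (B := M + d) ?_ hfloor
  by_contra! hlt
  rw [KoszulThreshold.minIndeg, lt_min_iff] at hlt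
  have h1 : ∀ μ : ℕ, (μ : ℤ) ≤ M + d → KoszulThreshold.H₁piece f d μ = ⊥ := by
    intro μ hμ
    refine KoszulThreshold.eq_bot_of_lt_indeg ?_
    have := hlt.1
    generalize KoszulThreshold.indeg (KoszulThreshold.H₁piece f d) = x at this
    induction x using ENat.recTopCoe with
    | top => exact ENat.natCast_lt_top μ
    | coe a =>
      rw [ENat.map_natCast] at this
      have := WithTop.coe_lt_coe.1 this
      exact Nat.cast_lt.2 (by omega)
  -- One d comes from the shift subtracted in the minimum, the other from the grading of
  -- R(-d)^(n+1); coefficient degrees thus reach M + d.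
  have h2 : ∀ μ : ℕ, (μ : ℤ) ≤ M + d + d → KoszulThreshold.H0H₁piece f d μ = ⊥ := by
    intro μ hμ
    refine KoszulThreshold.eq_bot_of_lt_indeg ?_
    have := hlt.2
    generalize KoszulThreshold.indeg (KoszulThreshold.H0H₁piece f d) = x at this
    induction x using ENat.recTopCoe with
    | top => exact ENat.natCast_lt_top μ
    | coe a =>
      rw [ENat.map_natCast] at this
      have := WithTop.coe_lt_coe.1 this
      exact Nat.cast_lt.2 (by omega)
  refine KoszulThreshold.not_koszulUpTo_and_torsionFreeUpTo (K := AlgebraicClosure k) (M := M)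
    (by omega) hd (by omega) (by omega)
    (fun i => KoszulThreshold.mem_homPiece_natCast.2 ((hf i).map _))
    ((KoszulThreshold.dimLEOne_of_ringKrullDim_le hdim).map _)
    ((KoszulThreshold.koszulUpTo_of_H₁piece h1).map _)
    ((KoszulThreshold.torsionFreeUpTo_of_H0H₁piece h2).map _)
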